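/- Let $a\in\mathbb R\setminus\{-1,2,3\}$, and consider the Picard–Fuchs system for $J=(J_{-1},J_0,J_1)^\top$, with $'=d/dt$: $$\begin{array}{l} tJ_{-1}'+(4-2a)J_0'+(a-1)J_1'=\frac13J_{-1},\\ (1-a)tJ_{-1}'+2atJ_0'+(3+2a-a^2)J_1'=\frac43aJ_0,\\ (a-2)tJ_{-1}'+(2-2a)tJ_0'+atJ_1'=\frac32(1-a)J_0+aJ_1. \end{array}\tag{1}$$ Then there are $r>0$ and a vector power series $Q$ with real coefficients, convergent for $|t|<r$, which solves (1) in the complex disc $|t|<r$ and has the form $$Q(t)=\begin{pmatrix}1\\0\\0\end{pmatrix}-\begin{pmatrix}\frac{a-1}{12(a-2)^2}\\ \frac1{6(a-2)}\\0\end{pmatrix}t-\begin{pmatrix}\frac{11a^2-22a+15}{576(a-2)^4}\\ \frac{a-1}{48(a-2)^3}\\ \frac1{72(a-2)^2}\end{pmatrix}t^2-\begin{pmatrix}\frac{35(a-1)(5a^2-10a+9)}{20736(a-2)^6}\\ \frac{85a^2-170a+105}{10368(a-2)^5}\\ \frac{5(a-1)}{864(a-2)^4}\end{pmatrix}t^3+\cdots,$$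 such that the following two statements hold. (i) If $a\ne0$, there is a vector power series $S$ with real coefficients, convergent for $|t|<r$, such that, with $$P(t)=\begin{pmatrix}3(a-1)\\ \frac{3(3+2a-a^2)}{4a}\\ \frac{9(a-1)(3+2a-a^2)}{8a^2}\end{pmatrix}+\begin{pmatrix}0\\0\\1\end{pmatrix}t ,$$ the functions $P(t)$, $Q(t)$, $R(t)=Q(t)\ln t+S(t)$ form a fundamental system of solutions of (1) (each is a solution, and every solution is a linear combination of them in exactly one way) on each of the real intervals $(-r,0)$ and $(0,r)$, where $\ln t$ is read as $\ln|t|$, and also on every domain $U\subset\{t\in\mathbb C:0<|t|<r\}$ on which a branch of $\ln t$ exists, for every such branch. (ii) Let $-1<a<2$ and $H(x,y)=x\,[\,y^2+ax^2-3(a-1)x+3(a-2)\,]$. For every $t\in(-r,0)$ the level curve $\{H=t\}$ contains an oval $\delta(t)$ surrounding the center $(1,0)$. There is a vector power series $D(t)=(D_{-1},D_0,D_1)^\top$ with real coefficients, convergent for $|t|<r$, such that for all $t\in(-r,0)$ and $k=-1,0,1$ the integrals $J_k(t)=\int_{\delta(t)}x^ky\,dx$, with $\delta(t)$ oriented along the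 Hamiltonian vector field $(H_y,-H_x)$, satisfy $$J_k(t)=-2\sqrt{3(2-a)}\;Q_k(t)\ln|t|+D_k(t),$$ where $Q=(Q_{-1},Q_0,Q_1)^\top$. -/

import Mathlib

open Set

noncomputable section

/-- The cubic Hamiltonian `H(x,y) = x (y² + a x² - 3(a-1) x + 3(a-2))`. -/
def hamH (a x y : ℝ) : ℝ := x * (y ^ 2 + a * x ^ 2 - 3 * (a - 1) * x + 3 * (a - 2))

/-- The Hamiltonian vector field `(H_y, -H_x)`. -/
def hamField (a : ℝ) (p : ℝ × ℝ) : ℝ × ℝ :=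
  (deriv (fun y => hamH a p.1 y) p.2, -deriv (fun x => hamH a x p.2) p.1)

/-- `γ` is a `C¹` simple closed parametrization (of period `1`) of an oval of the level curve
`H = t` that surrounds the center `(1,0)`, oriented along the Hamiltonian vector field.
"Surrounds": the center lies off the oval, in a bounded component of its complement. -/
structure IsOval (a t : ℝ) (γ : ℝ → ℝ × ℝ) : Prop where
  contDiff : ContDiff ℝ 1 γ
  periodic : Function.Periodic γ 1
  injOn : InjOn γ (Ico 0 1)
  level : ∀ s, hamH a (γ s).1 (γ s).2 = t
  oriented : ∀ s, ∃ ρ : ℝ, 0 < ρ ∧ deriv γ s = ρ • hamField a (γ s)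
  center_notMem : ((1, 0) : ℝ × ℝ) ∉ range γ
  surrounds : Bornology.IsBounded (connectedComponentIn (range γ)ᶜ ((1, 0) : ℝ × ℝ))

/-- The line integral `∮ x^k y dx` along the closed curve `γ` (of period `1`). -/
def ovalIntegral (γ : ℝ → ℝ × ℝ) (k : ℤ) : ℝ :=
  ∫ s in (0 : ℝ)..1, (γ s).1 ^ k * (γ s).2 * (deriv γ s).1

/-- `J` is a differentiable solution of the Picard–Fuchs system on the (open) set `U`, in the
real (`𝕜 = ℝ`) or complex (`𝕜 = ℂ`) variable `t`.
The components `J t 0, J t 1, J t 2` stand for `J_{-1}(t), J_0(t), J_1(t)`. -/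
def IsPFSolution {𝕜 : Type} [RCLike 𝕜] (a : ℝ) (U : Set 𝕜) (J : 𝕜 → Fin 3 → 𝕜) : Prop :=
  ∀ t ∈ U, DifferentiableAt 𝕜 J t ∧
    t * deriv J t 0 + (4 - 2 * (a : 𝕜)) * deriv J t 1 + ((a : 𝕜) - 1) * deriv J t 2
      = 1 / 3 * J t 0 ∧
    (1 - (a : 𝕜)) * t * deriv J t 0 + 2 * (a : 𝕜) * t * deriv J t 1
        + (3 + 2 * (a : 𝕜) - (a : 𝕜) ^ 2) * deriv J t 2
      = 4 / 3 * (a : 𝕜) * J t 1 ∧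
    ((a : 𝕜) - 2) * t * deriv J t 0 + (2 - 2 * (a : 𝕜)) * t * deriv J t 1
        + (a : 𝕜) * t * deriv J t 2
      = 3 / 2 * (1 - (a : 𝕜)) * J t 1 + (a : 𝕜) * J t 2

/-- `F 0, F 1, F 2` is a fundamental system of solutions of the Picard–Fuchs system on `U`:
each is a solution, and every solution is a linear combination of them in exactly one way. -/
def IsPFFundamental {𝕜 : Type} [RCLike 𝕜] (a : ℝ) (U : Set 𝕜)
    (F : Fin 3 → 𝕜 → Fin 3 → 𝕜) : Prop :=
  (∀ k, IsPFSolution a U (F k)) ∧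
    ∀ J : 𝕜 → Fin 3 → 𝕜, IsPFSolution a U J →
      ∃! c : Fin 3 → 𝕜, ∀ t ∈ U, J t = ∑ k, c k • F k t

/-- The vector power series with real coefficients `c` converges for `|t| < r`. (For real series
summability is absolute, so this also gives convergence in the complex disc of radius `r`.) -/
def VecSeriesConverges (c : ℕ → Fin 3 → ℝ) (r : ℝ) : Prop :=
  ∀ i, ∀ x : ℝ, |x| < r → Summable fun n => c n i * x ^ n

/-- The sum `∑ cₙ tⁿ` of a vector power series with real coefficients, at real or complex `t`. -/
def vecSeries {𝕜 : Type} [RCLike 𝕜] (c : ℕ → Fin 3 → ℝ) (t : 𝕜) : Fin 3 → 𝕜 :=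
  fun i => ∑' n, (c n i : 𝕜) * t ^ n

/-- The linear vector polynomial `P(t)`. -/
def linP {𝕜 : Type} [RCLike 𝕜] (a : ℝ) (t : 𝕜) : Fin 3 → 𝕜 :=
  ![3 * ((a : 𝕜) - 1),
    3 * (3 + 2 * (a : 𝕜) - (a : 𝕜) ^ 2) / (4 * (a : 𝕜)),
    9 * ((a : 𝕜) - 1) * (3 + 2 * (a : 𝕜) - (a : 𝕜) ^ 2) / (8 * (a : 𝕜) ^ 2) + t]

/-- The triple `P(t)`, `Q(t)`, `Q(t) ℓ(t) + S(t)`, where `Q`, `S` have the coefficients `q`, `s`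
and `ℓ` is a determination of the logarithm. -/
def logSystem {𝕜 : Type} [RCLike 𝕜] (a : ℝ) (q s : ℕ → Fin 3 → ℝ) (l : 𝕜 → 𝕜) :
    Fin 3 → 𝕜 → Fin 3 → 𝕜 :=
  ![linP a, vecSeries q, fun t => l t • vecSeries q t + vecSeries s t]

end

open scoped Real

noncomputable section

variable {𝕜 : Type} [RCLike 𝕜]

/-! Write (1) as A(t)J' = BJ. Then det A(t) = t · `pfDelta a t`, and `pfDelta` does not vanish at 0.
The second and first equations at order n, followed by the third at order n+1, determine the next
coefficient vector of a power series solution. This step is bounded uniformly in n, so formal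
solutions converge; the only constraint is the third equation at order 0, on the constant term. The
constant term (1,0,0) gives Q. Inserting Q ln t + S leaves an equation for S with forcing -A(t)Q/t.
The forcing is holomorphic because the last two components of Q vanish at 0, and S(0) can be chosen
to meet the constraint. The determinant of P, Q, S is nonzero at 0, and adding Q ln t to the last
column does not change it. Variation of constants (`isPFFundamental_of_det_ne_zero`) then gives (i).

For (ii), the coordinates u, with u² = H(x,0) - H(1,0), and w = √x y turn the ovals into circles of
radius ρ with ρ² = t + 3 - a. With g_k = x^(k-1/2) dx/du this gives J_k = 2∫ g_k(ρ cos θ) ρ² sin²θ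
dθ over [0,π] (`ovalIntegral_eq_abelInt`) and J_k' = ∫ g_k(ρ cos θ) dθ (`hasDerivAt_abelInt`). The
system (1) is the integral of pointwise identities modulo θ-derivatives (`isPFSolution_abelInt`), so
J = c₀P + c₁Q + c₂R up to rescaling P. The combination 3/2(1-a)J₀ + aJ₁ sees only c₂ as t → 0⁻: its
limit is (a-2)c₂. On the critical level y² = f(x) its integrand is -f'/2 · √f dx, which is exact, so
the limit equals (2/3) f(0)^(3/2) with f(0) = 3(2-a) (`tendsto_abelInt`). Hence c₂ = -2√(3(2-a)). -/

/-! ### Power series with geometrically bounded coefficients. -/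

/-- Geometric growth of a sequence of vectors. -/
def GeomBound (K : ℝ) (c : ℕ → Fin 3 → ℝ) : Prop := ∀ n i, |c n i| ≤ K ^ (n + 1)

/-- The termwise derivative of a vector power series. -/
def derivCoeff (c : ℕ → Fin 3 → ℝ) : ℕ → Fin 3 → ℝ := fun n i => (n + 1) * c (n + 1) i

theorem GeomBound.nonneg {K : ℝ} {c : ℕ → Fin 3 → ℝ} (h : GeomBound K c) : 0 ≤ K := by
  have := (abs_nonneg _).trans (h 0 0)
  simpa using this

theorem GeomBound.mono {K L : ℝ} {c : ℕ → Fin 3 → ℝ} (h : GeomBound K c) (hKL : K ≤ L) :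
    GeomBound L c :=
  fun n i => (h n i).trans (pow_le_pow_left₀ h.nonneg hKL _)

theorem GeomBound.summable {K : ℝ} {c : ℕ → Fin 3 → ℝ} (h : GeomBound K c) {t : 𝕜}
    (ht : K * ‖t‖ < 1) (i : Fin 3) : Summable fun n => (c n i : 𝕜) * t ^ n := by
  have hg : Summable fun n : ℕ => K * (K * ‖t‖) ^ n :=
    (summable_geometric_of_lt_one (mul_nonneg h.nonneg (norm_nonneg _)) ht).mul_left K
  refine Summable.of_norm_bounded hg fun n => ?_
  rw [norm_mul, norm_pow, RCLike.norm_ofReal]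
  calc |c n i| * ‖t‖ ^ n ≤ K ^ (n + 1) * ‖t‖ ^ n := by gcongr; exact h n i
    _ = _ := by ring

theorem GeomBound.hasDerivAt {K : ℝ} {c : ℕ → Fin 3 → ℝ} (h : GeomBound K c) {t : 𝕜}
    (ht : K * ‖t‖ < 1) : HasDerivAt (vecSeries c : 𝕜 → Fin 3 → 𝕜) (vecSeries (derivCoeff c) t) t ∧
      ∀ i, Summable fun n => (derivCoeff c n i : 𝕜) * t ^ n := by
  have hK := h.nonneg
  -- A slightly larger disc, on which the differentiated series is dominated uniformly.
  obtain ⟨ρ, hρ, hKρ⟩ : ∃ ρ : ℝ, ‖t‖ < ρ ∧ K * ρ < 1 := by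
    refine ⟨‖t‖ + (1 - K * ‖t‖) / (2 * (K + 1)), ?_, ?_⟩
    · have : 0 < (1 - K * ‖t‖) / (2 * (K + 1)) := div_pos (by linarith) (by linarith)
      linarith
    · have h1 : K * ((1 - K * ‖t‖) / (2 * (K + 1))) ≤ (1 - K * ‖t‖) / 2 := by
        rw [mul_div_assoc', div_le_div_iff₀ (by linarith) (by norm_num)]
        nlinarith
      rw [mul_add]; linarith
  have hρ0 : 0 < ρ := (norm_nonneg t).trans_lt hρ
  have hsum : Summable fun n : ℕ => K * K * ((n + 1) * (K * ρ) ^ n) := by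
    refine Summable.mul_left _ ?_
    have h1 := summable_pow_mul_geometric_of_norm_lt_one (R := ℝ) 1 (r := K * ρ)
      (by rw [Real.norm_of_nonneg (by positivity)]; exact hKρ)
    have h2 := summable_geometric_of_lt_one (by positivity : 0 ≤ K * ρ) hKρ
    refine (h1.add h2).congr fun n => by ring
  have hbound : ∀ i n (y : 𝕜), ‖y‖ < ρ →
      ‖(derivCoeff c n i : 𝕜) * y ^ n‖ ≤ K * K * ((n + 1) * (K * ρ) ^ n) := by
    intro i n y hy
    rw [norm_mul, norm_pow, RCLike.norm_ofReal, derivCoeff, abs_mul,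
      abs_of_nonneg (by positivity : (0 : ℝ) ≤ (n : ℝ) + 1)]
    calc ((n : ℝ) + 1) * |c (n + 1) i| * ‖y‖ ^ n ≤ (n + 1) * K ^ (n + 2) * ρ ^ n := by
          gcongr; exact h (n + 1) i
      _ = _ := by ring
  refine ⟨?_, fun i => Summable.of_norm_bounded hsum fun n => hbound i n t hρ⟩
  rw [hasDerivAt_pi]
  intro i
  have key : HasDerivAt (fun z : 𝕜 => ∑' n, (c (n + 1) i : 𝕜) * z ^ (n + 1))
      (∑' n, (derivCoeff c n i : 𝕜) * t ^ n) t := by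
    refine hasDerivAt_tsum_of_isPreconnected (g := fun n z => (c (n + 1) i : 𝕜) * z ^ (n + 1))
      (g' := fun n z => (derivCoeff c n i : 𝕜) * z ^ n) (t := Metric.ball (0 : 𝕜) ρ)
      (y₀ := 0) hsum Metric.isOpen_ball (convex_ball _ _).isPreconnected ?_ ?_ ?_ ?_ ?_
    · intro n y _
      have := (hasDerivAt_pow (n + 1) y).const_mul (c (n + 1) i : 𝕜)
      refine this.congr_deriv ?_
      simp only [derivCoeff, add_tsub_cancel_right]; push_cast
      ring
    · intro n y hy
      exact hbound i n y (by simpa using hy)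
    · simpa using hρ0
    · simp
    · simpa using hρ
  have hev : (fun z : 𝕜 => vecSeries c z i) =ᶠ[nhds t]
      fun z => (c 0 i : 𝕜) + ∑' n, (c (n + 1) i : 𝕜) * z ^ (n + 1) := by
    have : ∀ᶠ z : 𝕜 in nhds t, K * ‖z‖ < 1 :=
      (continuous_const.mul continuous_norm).continuousAt.eventually (gt_mem_nhds ht)
    filter_upwards [this] with z hz
    simp only [vecSeries]
    rw [(h.summable hz i).tsum_eq_zero_add]
    simp
  exact (key.const_add _).congr_of_eventuallyEq hev

theorem HasSum.of_eq {f g : ℕ → 𝕜} {x y : 𝕜} (h : HasSum f x) (hf : ∀ n, g n = f n)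
    (hx : y = x) : HasSum g y := by
  rw [hx, funext hf]; exact h

/-! ### The recursion for the coefficients and its convergence. -/

/-- The coefficient relations of the Picard–Fuchs system with forcing `e`. -/
structure IsPFCoeff (a : ℝ) (c e : ℕ → Fin 3 → ℝ) : Prop where
  first : ∀ n : ℕ, (n - 1 / 3) * c n 0 + (4 - 2 * a) * derivCoeff c n 1
    + (a - 1) * derivCoeff c n 2 = e n 0
  second : ∀ n : ℕ, (1 - a) * n * c n 0 + (2 * a * n - 4 / 3 * a) * c n 1
    + (3 + 2 * a - a ^ 2) * derivCoeff c n 2 = e n 1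
  third : ∀ n : ℕ, (a - 2) * n * c n 0 + ((2 - 2 * a) * n - 3 / 2 * (1 - a)) * c n 1
    + (a * n - a) * c n 2 = e n 2

theorem GeomBound.hasSum {K : ℝ} {c : ℕ → Fin 3 → ℝ} (h : GeomBound K c) {t : 𝕜}
    (ht : K * ‖t‖ < 1) (i : Fin 3) : HasSum (fun n => (c n i : 𝕜) * t ^ n) (vecSeries c t i) :=
  (h.summable ht i).hasSum

theorem GeomBound.hasSum_deriv {K : ℝ} {c : ℕ → Fin 3 → ℝ} (h : GeomBound K c) {t : 𝕜}
    (ht : K * ‖t‖ < 1) (i : Fin 3) :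
    HasSum (fun n => (derivCoeff c n i : 𝕜) * t ^ n) (vecSeries (derivCoeff c) t i) :=
  ((h.hasDerivAt ht).2 i).hasSum

theorem GeomBound.hasSum_mul_deriv {K : ℝ} {c : ℕ → Fin 3 → ℝ} (h : GeomBound K c) {t : 𝕜}
    (ht : K * ‖t‖ < 1) (i : Fin 3) :
    HasSum (fun n : ℕ => (n : 𝕜) * (c n i : 𝕜) * t ^ n) (t * vecSeries (derivCoeff c) t i) := by
  rw [← hasSum_nat_add_iff' 1]
  have := (h.hasSum_deriv ht i).mul_left t
  simp only [Finset.range_one, Finset.sum_singleton, Nat.cast_zero, zero_mul, sub_zero]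
  refine this.of_eq (fun n => ?_) rfl
  simp only [derivCoeff]; push_cast; ring

/-- A derivative multiplied by t contributes n cₙ at order n, and a bare derivative contributes
(n+1) cₙ₊₁. Hence the defect of the system is the forcing series, term by term. -/
theorem IsPFCoeff.series_eq {a K : ℝ} {c e : ℕ → Fin 3 → ℝ} (hc : IsPFCoeff a c e)
    (h : GeomBound K c) {t : 𝕜} (ht : K * ‖t‖ < 1) :
    HasSum (fun n => (e n 0 : 𝕜) * t ^ n)
      (t * vecSeries (derivCoeff c) t 0 + (4 - 2 * (a : 𝕜)) * vecSeries (derivCoeff c) t 1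
        + ((a : 𝕜) - 1) * vecSeries (derivCoeff c) t 2 - 1 / 3 * vecSeries c t 0) ∧
    HasSum (fun n => (e n 1 : 𝕜) * t ^ n)
      ((1 - (a : 𝕜)) * t * vecSeries (derivCoeff c) t 0
        + 2 * (a : 𝕜) * t * vecSeries (derivCoeff c) t 1
        + (3 + 2 * (a : 𝕜) - (a : 𝕜) ^ 2) * vecSeries (derivCoeff c) t 2
        - 4 / 3 * (a : 𝕜) * vecSeries c t 1) ∧
    HasSum (fun n => (e n 2 : 𝕜) * t ^ n)
      (((a : 𝕜) - 2) * t * vecSeries (derivCoeff c) t 0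
        + (2 - 2 * (a : 𝕜)) * t * vecSeries (derivCoeff c) t 1
        + (a : 𝕜) * t * vecSeries (derivCoeff c) t 2
        - (3 / 2 * (1 - (a : 𝕜)) * vecSeries c t 1 + (a : 𝕜) * vecSeries c t 2)) := by
  have h0 := h.hasSum ht
  have h1 := h.hasSum_deriv ht
  have h2 := h.hasSum_mul_deriv ht
  refine ⟨?_, ?_, ?_⟩
  · refine (((h2 0).add ((h1 1).mul_left (4 - 2 * (a : 𝕜)))).add
      ((h1 2).mul_left ((a : 𝕜) - 1))).sub ((h0 0).mul_left (1 / 3)) |>.of_eq (fun n => ?_) rfl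
    rw [← hc.first n]; push_cast; ring
  · refine ((((h2 0).mul_left (1 - (a : 𝕜))).add ((h2 1).mul_left (2 * (a : 𝕜)))).add
      ((h1 2).mul_left (3 + 2 * (a : 𝕜) - (a : 𝕜) ^ 2))).sub
      ((h0 1).mul_left (4 / 3 * (a : 𝕜))) |>.of_eq (fun n => ?_) (by ring)
    rw [← hc.second n]; push_cast; ring
  · refine ((((h2 0).mul_left ((a : 𝕜) - 2)).add ((h2 1).mul_left (2 - 2 * (a : 𝕜)))).add
      ((h2 2).mul_left (a : 𝕜))).sub
      (((h0 1).mul_left (3 / 2 * (1 - (a : 𝕜)))).add ((h0 2).mul_left (a : 𝕜)))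
      |>.of_eq (fun n => ?_) (by ring)
    rw [← hc.third n]; push_cast; ring

/-- One step of the recursion for the coefficients. -/
def pfStep (a : ℝ) (n : ℕ) (c e e' : Fin 3 → ℝ) : Fin 3 → ℝ :=
  let z := (e 1 + (4 / 3 * a - 2 * a * n) * c 1 - (1 - a) * n * c 0)
    / ((n + 1) * (3 + 2 * a - a ^ 2))
  let y := (e 0 + (1 / 3 - n) * c 0 - (a - 1) * (n + 1) * z) / ((n + 1) * (4 - 2 * a))
  let x := (e' 2 + ((2 * a - 2) * (n + 1) + 3 / 2 * (1 - a)) * y + (a - a * (n + 1)) * z)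
    / ((n + 1) * (a - 2))
  ![x, y, z]

/-- The solution of the coefficient relations with forcing `e` and constant term `c₀`. -/
def pfSeries (a : ℝ) (e : ℕ → Fin 3 → ℝ) (c₀ : Fin 3 → ℝ) : ℕ → Fin 3 → ℝ
  | 0 => c₀
  | n + 1 => pfStep a n (pfSeries a e c₀ n) (e n) (e (n + 1))

theorem quadratic_ne_zero {a : ℝ} (ha1 : a ≠ -1) (ha3 : a ≠ 3) : 3 + 2 * a - a ^ 2 ≠ 0 := by
  have : 3 + 2 * a - a ^ 2 = (a + 1) * (3 - a) := by ring
  rw [this]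
  exact mul_ne_zero (fun h => ha1 (by linarith)) (fun h => ha3 (by linarith))

/-- The step is triangular: the second relation at order n yields the last component, the first at
order n the middle one, the third at order n+1 the remaining one. No step produces the third
relation at order 0, which therefore has to be imposed as `h0`. -/
theorem isPFCoeff_pfSeries {a : ℝ} (ha1 : a ≠ -1) (ha2 : a ≠ 2) (ha3 : a ≠ 3)
    {e : ℕ → Fin 3 → ℝ} {c₀ : Fin 3 → ℝ}
    (h0 : - (3 / 2 * (1 - a) * c₀ 1) - a * c₀ 2 = e 0 2) :
    IsPFCoeff a (pfSeries a e c₀) e := by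
  have hD := quadratic_ne_zero ha1 ha3
  have h2 : a - 2 ≠ 0 := sub_ne_zero.2 ha2
  have h4 : 4 - 2 * a ≠ 0 := fun h => ha2 (by linarith)
  have hn : ∀ n : ℕ, (n : ℝ) + 1 ≠ 0 := fun n => by positivity
  have hz : ∀ n : ℕ, (3 + 2 * a - a ^ 2) * derivCoeff (pfSeries a e c₀) n 2
      = e n 1 + (4 / 3 * a - 2 * a * n) * pfSeries a e c₀ n 1
        - (1 - a) * n * pfSeries a e c₀ n 0 := by
    intro n
    have := hn n
    simp only [derivCoeff, pfSeries, pfStep, Matrix.cons_val]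
    field_simp
  refine ⟨fun n => ?_, fun n => ?_, fun n => ?_⟩
  · have := hn n
    simp only [derivCoeff, pfSeries, pfStep, Matrix.cons_val]
    -- The value of the last component is irrelevant here: the middle one is defined so as to
    -- satisfy the relation for any `z`.
    generalize (e n 1 + (4 / 3 * a - 2 * a * n) * pfSeries a e c₀ n 1
        - (1 - a) * n * pfSeries a e c₀ n 0) / ((n + 1) * (3 + 2 * a - a ^ 2)) = z
    field_simp
    ring
  · rw [hz n]; ring
  · cases n with
    | zero => simp only [pfSeries, ← h0]; push_cast; ring
    | succ n =>
      have := hn n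
      simp only [pfSeries, pfStep, Matrix.cons_val]
      generalize (e n 1 + (4 / 3 * a - 2 * a * n) * pfSeries a e c₀ n 1
        - (1 - a) * n * pfSeries a e c₀ n 0) / ((n + 1) * (3 + 2 * a - a ^ 2)) = z
      generalize (e n 0 + (1 / 3 - n) * pfSeries a e c₀ n 0 - (a - 1) * (n + 1) * z)
        / ((n + 1) * (4 - 2 * a)) = y
      push_cast
      field_simp
      ring

theorem abs_div_natSucc_mul_le {X d B m : ℝ} {n : ℕ} (hd : d ≠ 0) (hX : |X| ≤ (n + 1) * (B * m)) :
    |X / ((n + 1) * d)| ≤ B / |d| * m := by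
  have hd' : 0 < |d| := abs_pos.2 hd
  rw [abs_div, abs_mul, abs_of_nonneg (by positivity : (0 : ℝ) ≤ (n : ℝ) + 1),
    div_le_iff₀ (by positivity)]
  calc |X| ≤ _ := hX
    _ = _ := by field_simp

/-- Each numerator grows at most linearly in n and each denominator carries the factor n+1, so one
constant serves all n. This is what makes the radius of convergence positive. -/
theorem exists_pfStep_bound {a : ℝ} (ha1 : a ≠ -1) (ha2 : a ≠ 2) (ha3 : a ≠ 3) :
    ∃ A : ℝ, 0 ≤ A ∧ ∀ (n : ℕ) (c e e' : Fin 3 → ℝ) (m : ℝ), (∀ i, |c i| ≤ m) →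
      (∀ i, |e i| ≤ m) → (∀ i, |e' i| ≤ m) → ∀ i, |pfStep a n c e e' i| ≤ A * m := by
  have hD := quadratic_ne_zero ha1 ha3
  have h2 : a - 2 ≠ 0 := sub_ne_zero.2 ha2
  have h4 : 4 - 2 * a ≠ 0 := fun h => ha2 (by linarith)
  set A₂ : ℝ := (1 + 4 * |a| + |1 - a|) / |3 + 2 * a - a ^ 2| with hA₂
  set A₁ : ℝ := (3 + |a - 1| * A₂) / |4 - 2 * a| with hA₁
  set A₀ : ℝ := (1 + (|2 * a - 2| + |3 / 2 * (1 - a)|) * A₁ + |a| * A₂) / |a - 2| with hA₀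
  have p2 : 0 ≤ A₂ := by positivity
  have p1 : 0 ≤ A₁ := by positivity
  have p0 : 0 ≤ A₀ := by positivity
  refine ⟨A₀ + A₁ + A₂, by positivity, fun n c e e' m hc he he' => ?_⟩
  have hm : 0 ≤ m := (abs_nonneg _).trans (hc 0)
  have hn0 : (0 : ℝ) ≤ n := Nat.cast_nonneg n
  have tri : ∀ {u v w U V W : ℝ}, |u| ≤ U → |v| ≤ V → |w| ≤ W → |u + v + w| ≤ U + V + W :=
    fun hu hv hw => (abs_add_three _ _ _).trans (by linarith)
  have hz : |(e 1 + (4 / 3 * a - 2 * a * n) * c 1 - (1 - a) * n * c 0)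
      / ((n + 1) * (3 + 2 * a - a ^ 2))| ≤ A₂ * m := by
    refine abs_div_natSucc_mul_le hD ?_
    have e1 : |(4 / 3 * a - 2 * a * n) * c 1| ≤ 4 * |a| * (n + 1) * m := by
      rw [abs_mul]
      refine mul_le_mul ?_ (hc 1) (abs_nonneg _) (by positivity)
      have : |4 / 3 * a - 2 * a * n| = |a| * |4 / 3 - 2 * (n : ℝ)| := by rw [← abs_mul]; ring_nf
      rw [this, mul_comm 4, mul_assoc]
      refine mul_le_mul_of_nonneg_left ?_ (abs_nonneg _)
      rw [abs_le]; constructor <;> linarith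
    have e2 : |-((1 - a) * n * c 0)| ≤ |1 - a| * (n + 1) * m := by
      rw [abs_neg, abs_mul, abs_mul, abs_of_nonneg hn0]
      gcongr
      · linarith
      · exact hc 0
    rw [sub_eq_add_neg]
    refine (tri (he 1) e1 e2).trans ?_
    nlinarith [mul_nonneg hn0 hm]
  simp only [pfStep]
  generalize (e 1 + (4 / 3 * a - 2 * a * n) * c 1 - (1 - a) * n * c 0)
      / ((n + 1) * (3 + 2 * a - a ^ 2)) = z at hz ⊢
  have hy : |(e 0 + (1 / 3 - n) * c 0 - (a - 1) * (n + 1) * z) / ((n + 1) * (4 - 2 * a))|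
      ≤ A₁ * m := by
    refine abs_div_natSucc_mul_le h4 ?_
    have e1 : |(1 / 3 - (n : ℝ)) * c 0| ≤ (n + 1) * m := by
      rw [abs_mul]
      refine mul_le_mul ?_ (hc 0) (abs_nonneg _) (by positivity)
      rw [abs_le]; constructor <;> linarith
    have e2 : |-((a - 1) * (n + 1) * z)| ≤ |a - 1| * (n + 1) * (A₂ * m) := by
      rw [abs_neg, abs_mul, abs_mul, abs_of_nonneg (by positivity : (0 : ℝ) ≤ (n : ℝ) + 1)]
      gcongr
    rw [sub_eq_add_neg]
    refine (tri (he 0) e1 e2).trans ?_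
    nlinarith [mul_nonneg hn0 hm]
  generalize (e 0 + (1 / 3 - n) * c 0 - (a - 1) * (n + 1) * z) / ((n + 1) * (4 - 2 * a)) = y
    at hy ⊢
  have hx : |(e' 2 + ((2 * a - 2) * (n + 1) + 3 / 2 * (1 - a)) * y + (a - a * (n + 1)) * z)
      / ((n + 1) * (a - 2))| ≤ A₀ * m := by
    refine abs_div_natSucc_mul_le h2 ?_
    have e1 : |((2 * a - 2) * (n + 1) + 3 / 2 * (1 - a)) * y|
        ≤ (|2 * a - 2| + |3 / 2 * (1 - a)|) * (n + 1) * (A₁ * m) := by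
      rw [abs_mul]
      refine mul_le_mul ?_ hy (abs_nonneg _) (by positivity)
      refine (abs_add_le _ _).trans ?_
      rw [abs_mul, abs_of_nonneg (by positivity : (0 : ℝ) ≤ (n : ℝ) + 1)]
      nlinarith [mul_nonneg hn0 (abs_nonneg (3 / 2 * (1 - a)))]
    have e2 : |(a - a * (n + 1)) * z| ≤ |a| * (n + 1) * (A₂ * m) := by
      have : (a - a * (n + 1)) * z = -(a * n * z) := by ring
      rw [this, abs_neg, abs_mul, abs_mul, abs_of_nonneg hn0]
      gcongr
      linarith
    refine (tri (he' 2) e1 e2).trans ?_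
    nlinarith [mul_nonneg hn0 hm]
  intro i
  fin_cases i
  · exact hx.trans (by nlinarith)
  · exact hy.trans (by nlinarith)
  · exact hz.trans (by nlinarith)

theorem exists_geomBound_pfSeries {a : ℝ} (ha1 : a ≠ -1) (ha2 : a ≠ 2) (ha3 : a ≠ 3)
    {E : ℝ} {e : ℕ → Fin 3 → ℝ} (he : GeomBound E e) (c₀ : Fin 3 → ℝ) :
    ∃ K, GeomBound K (pfSeries a e c₀) := by
  obtain ⟨A, hA, hstep⟩ := exists_pfStep_bound ha1 ha2 ha3
  have hE := he.nonneg
  refine ⟨∑ i, |c₀ i| + E + 1 + A * (1 + E), ?_⟩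
  set K := ∑ i, |c₀ i| + E + 1 + A * (1 + E) with hKdef
  have hsum : 0 ≤ ∑ i, |c₀ i| := Finset.sum_nonneg fun i _ => abs_nonneg _
  have hAE : 0 ≤ A * (1 + E) := by positivity
  have hEK : E ≤ K := by linarith
  have hK0 : 0 ≤ K := hE.trans hEK
  intro n
  induction n with
  | zero =>
    intro i
    have : |c₀ i| ≤ ∑ i, |c₀ i| :=
      Finset.single_le_sum (f := fun i => |c₀ i|) (fun i _ => abs_nonneg _) (Finset.mem_univ i)
    simp only [pfSeries, zero_add, pow_one]
    linarith
  | succ n ih =>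
    intro i
    have hpow : E ^ (n + 1) ≤ K ^ (n + 1) := pow_le_pow_left₀ hE hEK _
    have hKn : 0 ≤ K ^ (n + 1) := by positivity
    -- The common bound (1+E)K^(n+1) covers all three inputs, the factor E being needed for the
    -- forcing of index n+1. The summand A(1+E) of K pays for the step.
    refine (hstep n _ (e n) (e (n + 1)) ((1 + E) * K ^ (n + 1)) (fun i => (ih i).trans ?_)
      (fun i => (he n i).trans ?_) (fun i => (he (n + 1) i).trans ?_) i).trans ?_
    · nlinarith
    · nlinarith
    · rw [pow_succ E (n + 1)]; nlinarith
    · rw [pow_succ K (n + 1), ← mul_assoc, mul_comm]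
      exact mul_le_mul_of_nonneg_left (by linarith) hKn

/-! ### Independent solutions form a fundamental system. -/

/-- The determinant of the matrix of the derivatives in the Picard–Fuchs system, divided by `t`. -/
def pfDelta (a : ℝ) (t : 𝕜) : 𝕜 :=
  2 * (a : 𝕜) ^ 2 * t ^ 2 - (3 + 2 * (a : 𝕜) - (a : 𝕜) ^ 2) * (2 - 2 * (a : 𝕜)) * t
    - (4 - 2 * (a : 𝕜)) * ((1 - (a : 𝕜)) * a * t
      - (3 + 2 * (a : 𝕜) - (a : 𝕜) ^ 2) * ((a : 𝕜) - 2))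
    + ((a : 𝕜) - 1) * ((1 - (a : 𝕜)) * (2 - 2 * (a : 𝕜)) * t - 2 * (a : 𝕜) * t * ((a : 𝕜) - 2))

/-- Cramer's rule in the unknowns `t * v 0`, `v 1`, `v 2`, whose matrix has determinant `pfDelta a
t`; the multipliers below are its cofactors. -/
theorem pf_kernel_eq_zero {a : ℝ} {t : 𝕜} (ht : t ≠ 0) (hΔ : pfDelta a t ≠ 0) {v : Fin 3 → 𝕜}
    (h1 : t * v 0 + (4 - 2 * (a : 𝕜)) * v 1 + ((a : 𝕜) - 1) * v 2 = 0)
    (h2 : (1 - (a : 𝕜)) * t * v 0 + 2 * (a : 𝕜) * t * v 1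
        + (3 + 2 * (a : 𝕜) - (a : 𝕜) ^ 2) * v 2 = 0)
    (h3 : ((a : 𝕜) - 2) * t * v 0 + (2 - 2 * (a : 𝕜)) * t * v 1 + (a : 𝕜) * t * v 2 = 0) :
    v = 0 := by
  set A : 𝕜 := (a : 𝕜) with hA
  have hd : pfDelta a t = 2 * A ^ 2 * t ^ 2 - (3 + 2 * A - A ^ 2) * (2 - 2 * A) * t
    - (4 - 2 * A) * ((1 - A) * A * t - (3 + 2 * A - A ^ 2) * (A - 2))
    + (A - 1) * ((1 - A) * (2 - 2 * A) * t - 2 * A * t * (A - 2)) := rfl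
  have e0 : pfDelta a t * (t * v 0) = 0 := by
    rw [hd]
    linear_combination (2 * A ^ 2 * t ^ 2 - (3 + 2 * A - A ^ 2) * (2 - 2 * A) * t) * h1
      - ((4 - 2 * A) * A * t - (A - 1) * (2 - 2 * A) * t) * h2
      + ((4 - 2 * A) * (3 + 2 * A - A ^ 2) - (A - 1) * (2 * A * t)) * h3
  have e1 : pfDelta a t * v 1 = 0 := by
    rw [hd]
    linear_combination -((1 - A) * A * t - (3 + 2 * A - A ^ 2) * (A - 2)) * h1
      + (A * t - (A - 1) * (A - 2)) * h2 - ((3 + 2 * A - A ^ 2) - (A - 1) * (1 - A)) * h3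
  have e2 : pfDelta a t * v 2 = 0 := by
    rw [hd]
    linear_combination ((1 - A) * (2 - 2 * A) * t - 2 * A * t * (A - 2)) * h1
      - ((2 - 2 * A) * t - (4 - 2 * A) * (A - 2)) * h2 + (2 * A * t - (4 - 2 * A) * (1 - A)) * h3
  ext i
  fin_cases i
  · simpa [hΔ, ht] using e0
  · simpa [hΔ] using e1
  · simpa [hΔ] using e2

/-- The matrix with columns `F 0 t, F 1 t, F 2 t`. -/
def solMatrix (F : Fin 3 → 𝕜 → Fin 3 → 𝕜) (t : 𝕜) : Matrix (Fin 3) (Fin 3) 𝕜 :=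
  Matrix.of fun i k => F k t i

theorem differentiableAt_det_fin_three {B : 𝕜 → Matrix (Fin 3) (Fin 3) 𝕜} {t : 𝕜}
    (h : ∀ i j, DifferentiableAt 𝕜 (fun s => B s i j) t) :
    DifferentiableAt 𝕜 (fun s => (B s).det) t := by
  simp only [Matrix.det_fin_three]
  fun_prop

/-- Variation of constants. Cramer's rule writes J = ∑ cₖFₖ with differentiable cₖ. Since J and the
Fₖ solve the same linear system, ∑ cₖ'Fₖ lies in the kernel of the derivative matrix and vanishes.
So every cₖ' is 0, and cₖ is constant on the connected set. -/
theorem isPFFundamental_of_det_ne_zero {a : ℝ} {U : Set 𝕜} (hU : IsOpen U) (hc : IsConnected U)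
    {F : Fin 3 → 𝕜 → Fin 3 → 𝕜} (hF : ∀ k, IsPFSolution a U (F k))
    (hdet : ∀ t ∈ U, (solMatrix F t).det ≠ 0) (hΔ : ∀ t ∈ U, t ≠ 0 ∧ pfDelta a t ≠ 0) :
    IsPFFundamental a U F := by
  refine ⟨hF, fun J hJ => ?_⟩
  obtain ⟨t₀, ht₀⟩ := hc.nonempty
  set c : Fin 3 → 𝕜 → 𝕜 := fun k t =>
    ((solMatrix F t).updateCol k (J t)).det / (solMatrix F t).det with hcdef
  have hFd : ∀ t ∈ U, ∀ k i, DifferentiableAt 𝕜 (fun s => F k s i) t := fun t ht k i =>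
    (differentiableAt_pi.1 (hF k t ht).1) i
  have hJd : ∀ t ∈ U, ∀ i, DifferentiableAt 𝕜 (fun s => J s i) t := fun t ht i =>
    (differentiableAt_pi.1 (hJ t ht).1) i
  have hcd : ∀ t ∈ U, ∀ k, DifferentiableAt 𝕜 (c k) t := by
    intro t ht k
    refine DifferentiableAt.div (differentiableAt_det_fin_three fun i j => ?_)
      (differentiableAt_det_fin_three fun i j => hFd t ht j i) (hdet t ht)
    simp only [Matrix.updateCol_apply]
    split_ifs
    · exact hJd t ht i
    · exact hFd t ht j i
  have hrep : ∀ t ∈ U, ∀ i, J t i = ∑ k, c k t * F k t i := by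
    intro t ht i
    have h := congrFun (Matrix.mulVec_cramer (solMatrix F t) (J t)) i
    simp only [Matrix.mulVec, dotProduct, Pi.smul_apply, smul_eq_mul, Matrix.cramer_apply] at h
    have hd := hdet t ht
    simp only [hcdef, div_mul_eq_mul_div]
    rw [← Finset.sum_div, eq_div_iff hd, mul_comm, ← h]
    exact Finset.sum_congr rfl fun k _ => mul_comm _ _
  have hzero : ∀ t ∈ U, ∀ k, deriv (c k) t = 0 := by
    intro t ht
    have hder : ∀ i, deriv J t i = ∑ k, (deriv (c k) t * F k t i + c k t * deriv (F k) t i) := by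
      intro i
      have hFk : ∀ k, HasDerivAt (fun s => F k s i) (deriv (F k) t i) t := fun k =>
        hasDerivAt_pi.1 (hF k t ht).1.hasDerivAt i
      have h1 : HasDerivAt (fun s => J s i) (deriv J t i) t :=
        hasDerivAt_pi.1 (hJ t ht).1.hasDerivAt i
      have h2 : HasDerivAt (fun s => ∑ k, c k s * F k s i)
          (∑ k, (deriv (c k) t * F k t i + c k t * deriv (F k) t i)) t :=
        HasDerivAt.fun_sum fun k _ => (hcd t ht k).hasDerivAt.mul (hFk k)
      have h3 : (fun s => J s i) =ᶠ[nhds t] fun s => ∑ k, c k s * F k s i := by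
        filter_upwards [hU.mem_nhds ht] with s hs using hrep s hs i
      exact h1.unique (h2.congr_of_eventuallyEq h3)
    have hv : (fun i => ∑ k, deriv (c k) t * F k t i) = (0 : Fin 3 → 𝕜) := by
      obtain ⟨-, j1, j2, j3⟩ := hJ t ht
      obtain ⟨-, a1, a2, a3⟩ := hF 0 t ht
      obtain ⟨-, b1, b2, b3⟩ := hF 1 t ht
      obtain ⟨-, c1, c2, c3⟩ := hF 2 t ht
      simp only [hder, hrep t ht, Fin.sum_univ_three] at j1 j2 j3
      apply pf_kernel_eq_zero (hΔ t ht).1 (hΔ t ht).2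
      · simp only [Fin.sum_univ_three]
        linear_combination j1 - c 0 t * a1 - c 1 t * b1 - c 2 t * c1
      · simp only [Fin.sum_univ_three]
        linear_combination j2 - c 0 t * a2 - c 1 t * b2 - c 2 t * c2
      · simp only [Fin.sum_univ_three]
        linear_combination j3 - c 0 t * a3 - c 1 t * b3 - c 2 t * c3
    have hk := Matrix.eq_zero_of_mulVec_eq_zero (M := solMatrix F t)
      (v := fun k => deriv (c k) t) (hdet t ht) (by
        rw [← hv]
        ext i
        simp only [Matrix.mulVec, dotProduct, solMatrix, Matrix.of_apply]
        exact Finset.sum_congr rfl fun k _ => mul_comm _ _)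
    exact fun k => congrFun hk k
  have hconst : ∀ t ∈ U, ∀ k, c k t = c k t₀ := fun t ht k =>
    hU.is_const_of_deriv_eq_zero hc.isPreconnected
      (fun s hs => (hcd s hs k).differentiableWithinAt) (fun s hs => hzero s hs k) ht ht₀
  refine ⟨fun k => c k t₀, fun t ht => ?_, fun c' hc' => ?_⟩
  · ext i
    rw [hrep t ht i]
    simp only [Finset.sum_apply, Pi.smul_apply, smul_eq_mul]
    exact Finset.sum_congr rfl fun k _ => by rw [hconst t ht k]
  · have h0 := Matrix.eq_zero_of_mulVec_eq_zero (M := solMatrix F t₀)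
      (v := fun k => c' k - c k t₀) (hdet t₀ ht₀) (by
        ext i
        have e1 := congrFun (hc' t₀ ht₀) i
        have e2 := hrep t₀ ht₀ i
        simp only [Finset.sum_apply, Pi.smul_apply, smul_eq_mul] at e1
        rw [e2] at e1
        simp only [Matrix.mulVec, dotProduct, solMatrix, Matrix.of_apply, Pi.zero_apply, mul_sub,
          Finset.sum_sub_distrib]
        rw [sub_eq_zero, Finset.sum_congr rfl fun k _ => mul_comm (F k t₀ i) (c' k),
          Finset.sum_congr rfl fun k _ => mul_comm (F k t₀ i) (c k t₀), e1])
    ext k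
    exact sub_eq_zero.1 (congrFun h0 k)

/-! ### The holomorphic and the logarithmic solution. -/

/-- The coefficients of the holomorphic solution with constant term `(1,0,0)`. -/
def holCoeff (a : ℝ) : ℕ → Fin 3 → ℝ := pfSeries a 0 ![1, 0, 0]

/-- The forcing produced by the logarithm. -/
def logForcing (a : ℝ) (n : ℕ) : Fin 3 → ℝ :=
  -![holCoeff a n 0 + (4 - 2 * a) * holCoeff a (n + 1) 1 + (a - 1) * holCoeff a (n + 1) 2,
    (1 - a) * holCoeff a n 0 + 2 * a * holCoeff a n 1
      + (3 + 2 * a - a ^ 2) * holCoeff a (n + 1) 2,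
    (a - 2) * holCoeff a n 0 + (2 - 2 * a) * holCoeff a n 1 + a * holCoeff a n 2]

/-- The coefficients of the holomorphic part of the logarithmic solution. -/
def logCoeff (a : ℝ) : ℕ → Fin 3 → ℝ := pfSeries a (logForcing a)
  ![0, (a - 2) * (3 / 2 * (1 - a)) / (9 / 4 * (1 - a) ^ 2 + a ^ 2),
    (a - 2) * a / (9 / 4 * (1 - a) ^ 2 + a ^ 2)]

/-- This is the order-0 constraint for S. It is met by a multiple of the vector (3/2(1-a), a), whose
squared length, the denominator, vanishes for no real a; thus a = 0 is covered too. -/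
theorem logCoeff_zero_eq (a : ℝ) :
    3 / 2 * (1 - a) * logCoeff a 0 1 + a * logCoeff a 0 2 = a - 2 := by
  have h : 9 / 4 * (1 - a) ^ 2 + a ^ 2 ≠ 0 := by
    nlinarith [sq_nonneg (1 - 2 * a), sq_nonneg (1 - a), sq_nonneg a]
  simp only [logCoeff, pfSeries, Matrix.cons_val]
  calc _ = (a - 2) * ((9 / 4 * (1 - a) ^ 2 + a ^ 2) / (9 / 4 * (1 - a) ^ 2 + a ^ 2)) := by ring
    _ = a - 2 := by rw [div_self h, mul_one]

theorem isPFCoeff_holCoeff {a : ℝ} (ha1 : a ≠ -1) (ha2 : a ≠ 2) (ha3 : a ≠ 3) :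
    IsPFCoeff a (holCoeff a) 0 :=
  isPFCoeff_pfSeries ha1 ha2 ha3 (by simp)

theorem isPFCoeff_logCoeff {a : ℝ} (ha1 : a ≠ -1) (ha2 : a ≠ 2) (ha3 : a ≠ 3) :
    IsPFCoeff a (logCoeff a) (logForcing a) := by
  refine isPFCoeff_pfSeries ha1 ha2 ha3 ?_
  have := logCoeff_zero_eq a
  simp only [logCoeff, pfSeries, Matrix.cons_val] at this
  simp only [logForcing, holCoeff, pfSeries, Pi.neg_apply, Matrix.cons_val]
  linarith

theorem exists_geomBound_holCoeff_logCoeff {a : ℝ} (ha1 : a ≠ -1) (ha2 : a ≠ 2) (ha3 : a ≠ 3) :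
    ∃ K, GeomBound K (holCoeff a) ∧ GeomBound K (logCoeff a) := by
  obtain ⟨K₀, hK₀⟩ := exists_geomBound_pfSeries ha1 ha2 ha3 (E := 0) (e := 0)
    (fun n i => by simp) ![1, 0, 0]
  obtain ⟨K, hK1, hK⟩ : ∃ K, 1 ≤ K ∧ GeomBound K (holCoeff a) :=
    ⟨max 1 K₀, le_max_left _ _, hK₀.mono (le_max_right _ _)⟩
  set B : ℝ := 1 + (1 + |4 - 2 * a| + |a - 1|) + (|1 - a| + |2 * a| + |3 + 2 * a - a ^ 2|)
    + (|a - 2| + |2 - 2 * a| + |a|) with hB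
  have hB1 : 1 ≤ B := by
    have : 0 ≤ (1 + |4 - 2 * a| + |a - 1|) + (|1 - a| + |2 * a| + |3 + 2 * a - a ^ 2|)
      + (|a - 2| + |2 - 2 * a| + |a|) := by positivity
    linarith
  have hforce : GeomBound (B * K ^ 2) (logForcing a) := by
    intro n
    -- The forcing involves the coefficient of index n+1, bounded by K^(n+2); the rate K² absorbs
    -- this shift.
    have hpow : B * K ^ (n + 2) ≤ (B * K ^ 2) ^ (n + 1) := by
      rw [mul_pow, ← pow_mul]
      exact mul_le_mul (le_self_pow₀ hB1 (by omega)) (pow_le_pow_right₀ hK1 (by omega))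
        (by positivity) (by positivity)
    have hn : ∀ i, |holCoeff a n i| ≤ K ^ (n + 2) := fun i =>
      (hK n i).trans (pow_le_pow_right₀ hK1 (by omega))
    have hn' : ∀ i, |holCoeff a (n + 1) i| ≤ K ^ (n + 2) := fun i => hK (n + 1) i
    have hKn : 0 ≤ K ^ (n + 2) := by positivity
    have tri : ∀ {x y z u v w : ℝ}, |u| ≤ K ^ (n + 2) → |v| ≤ K ^ (n + 2) → |w| ≤ K ^ (n + 2) →
        |x| + |y| + |z| ≤ B → |-(x * u + y * v + z * w)| ≤ (B * K ^ 2) ^ (n + 1) := by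
      intro x y z u v w hu hv hw hxyz
      rw [abs_neg]
      refine (abs_add_three _ _ _).trans (le_trans ?_ hpow)
      rw [abs_mul, abs_mul, abs_mul]
      have := mul_le_mul_of_nonneg_left hu (abs_nonneg x)
      have := mul_le_mul_of_nonneg_left hv (abs_nonneg y)
      have := mul_le_mul_of_nonneg_left hw (abs_nonneg z)
      have := mul_le_mul_of_nonneg_right hxyz hKn
      linarith
    intro i
    have p1 := abs_nonneg (4 - 2 * a)
    have p2 := abs_nonneg (a - 1)
    have p3 := abs_nonneg (1 - a)
    have p4 := abs_nonneg (2 * a)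
    have p5 := abs_nonneg (3 + 2 * a - a ^ 2)
    have p6 := abs_nonneg (a - 2)
    have p7 := abs_nonneg (2 - 2 * a)
    have p8 := abs_nonneg a
    fin_cases i
    · have := tri (x := 1) (y := 4 - 2 * a) (z := a - 1) (hn 0) (hn' 1) (hn' 2)
        (by rw [abs_one]; linarith)
      rw [one_mul] at this
      exact this
    · exact tri (hn 0) (hn 1) (hn' 2) (by linarith)
    · exact tri (hn 0) (hn 1) (hn 2) (by linarith)
  obtain ⟨L, hL⟩ := exists_geomBound_pfSeries ha1 ha2 ha3 hforce
    ![0, (a - 2) * (3 / 2 * (1 - a)) / (9 / 4 * (1 - a) ^ 2 + a ^ 2),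
      (a - 2) * a / (9 / 4 * (1 - a) ^ 2 + a ^ 2)]
  exact ⟨max K L, hK.mono (le_max_left _ _), hL.mono (le_max_right _ _)⟩

theorem isPFSolution_holCoeff {a K : ℝ} (ha1 : a ≠ -1) (ha2 : a ≠ 2) (ha3 : a ≠ 3)
    (hK : GeomBound K (holCoeff a)) {U : Set 𝕜} (hU : ∀ t ∈ U, K * ‖t‖ < 1) :
    IsPFSolution a U (vecSeries (holCoeff a)) := by
  intro t ht
  have hd := (hK.hasDerivAt (hU t ht)).1
  obtain ⟨h1, h2, h3⟩ := (isPFCoeff_holCoeff ha1 ha2 ha3).series_eq hK (hU t ht)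
  have z : ∀ i, (fun n : ℕ => (((0 : ℕ → Fin 3 → ℝ) n i : ℝ) : 𝕜) * t ^ n) = fun _ => 0 := by
    intro i; ext n; simp
  rw [z] at h1 h2 h3
  rw [hd.deriv]
  exact ⟨hd.differentiableAt, sub_eq_zero.1 (h1.unique hasSum_zero),
    sub_eq_zero.1 (h2.unique hasSum_zero), sub_eq_zero.1 (h3.unique hasSum_zero)⟩

/-- The sums are -A(t)Q(t)/t. Entries of A without a factor t meet only the last two components of
Q, which vanish at 0, so there division by t is an index shift. -/
theorem hasSum_logForcing {a K : ℝ} (hK : GeomBound K (holCoeff a)) {t : 𝕜} (ht0 : t ≠ 0)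
    (ht : K * ‖t‖ < 1) :
    HasSum (fun n => (logForcing a n 0 : 𝕜) * t ^ n)
      (-(vecSeries (holCoeff a) t 0 + (4 - 2 * (a : 𝕜)) * (t⁻¹ * vecSeries (holCoeff a) t 1)
        + ((a : 𝕜) - 1) * (t⁻¹ * vecSeries (holCoeff a) t 2))) ∧
    HasSum (fun n => (logForcing a n 1 : 𝕜) * t ^ n)
      (-((1 - (a : 𝕜)) * vecSeries (holCoeff a) t 0 + 2 * (a : 𝕜) * vecSeries (holCoeff a) t 1
        + (3 + 2 * (a : 𝕜) - (a : 𝕜) ^ 2) * (t⁻¹ * vecSeries (holCoeff a) t 2))) ∧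
    HasSum (fun n => (logForcing a n 2 : 𝕜) * t ^ n)
      (-(((a : 𝕜) - 2) * vecSeries (holCoeff a) t 0
        + (2 - 2 * (a : 𝕜)) * vecSeries (holCoeff a) t 1
        + (a : 𝕜) * vecSeries (holCoeff a) t 2)) := by
  have h0 := fun i => hK.hasSum ht i
  have h1 : ∀ i, holCoeff a 0 i = 0 →
      HasSum (fun n => (holCoeff a (n + 1) i : 𝕜) * t ^ n) (t⁻¹ * vecSeries (holCoeff a) t i) := by
    intro i hi
    have := ((hasSum_nat_add_iff' 1).2 (h0 i)).mul_left t⁻¹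
    refine this.of_eq (fun n => ?_) ?_
    · rw [pow_succ]; field_simp
    · simp [hi]
  have s1 := h1 1 (by simp [holCoeff, pfSeries])
  have s2 := h1 2 (by simp [holCoeff, pfSeries])
  refine ⟨?_, ?_, ?_⟩
  · refine (((h0 0).add (s1.mul_left (4 - 2 * (a : 𝕜)))).add
      (s2.mul_left ((a : 𝕜) - 1))).neg.of_eq (fun n => ?_) rfl
    simp only [logForcing, Pi.neg_apply, Matrix.cons_val]; push_cast; ring
  · refine ((((h0 0).mul_left (1 - (a : 𝕜))).add ((h0 1).mul_left (2 * (a : 𝕜)))).add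
      (s2.mul_left (3 + 2 * (a : 𝕜) - (a : 𝕜) ^ 2))).neg.of_eq (fun n => ?_) rfl
    simp only [logForcing, Pi.neg_apply, Matrix.cons_val]; push_cast; ring
  · refine ((((h0 0).mul_left ((a : 𝕜) - 2)).add ((h0 1).mul_left (2 - 2 * (a : 𝕜)))).add
      ((h0 2).mul_left (a : 𝕜))).neg.of_eq (fun n => ?_) rfl
    simp only [logForcing, Pi.neg_apply, Matrix.cons_val]; push_cast; ring

/-- The terms containing `l t` cancel because Q is a solution; those from l' = 1/t cancel against
the forcing of S. Only the derivative of `l` matters, so ln|t| and complex branches are treated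
alike. -/
theorem isPFSolution_log {a K : ℝ} (ha1 : a ≠ -1) (ha2 : a ≠ 2) (ha3 : a ≠ 3)
    (hK : GeomBound K (holCoeff a)) (hL : GeomBound K (logCoeff a)) {U : Set 𝕜} {l : 𝕜 → 𝕜}
    (hU : ∀ t ∈ U, K * ‖t‖ < 1 ∧ t ≠ 0 ∧ HasDerivAt l t⁻¹ t) :
    IsPFSolution a U (fun t => l t • vecSeries (holCoeff a) t + vecSeries (logCoeff a) t) := by
  intro t ht
  obtain ⟨htK, ht0, hl⟩ := hU t ht
  have hQ := (hK.hasDerivAt htK).1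
  have hS := (hL.hasDerivAt htK).1
  have hR := (hl.smul hQ).add hS
  obtain ⟨-, q1, q2, q3⟩ := isPFSolution_holCoeff ha1 ha2 ha3 hK
    (U := {t}) (by simpa using htK) t rfl
  rw [hQ.deriv] at q1 q2 q3
  obtain ⟨f1, f2, f3⟩ := hasSum_logForcing hK ht0 htK
  obtain ⟨s1, s2, s3⟩ := (isPFCoeff_logCoeff ha1 ha2 ha3).series_eq hL htK
  have e1 := s1.unique f1
  have e2 := s2.unique f2
  have e3 := s3.unique f3
  have hcancel : t * t⁻¹ = 1 := mul_inv_cancel₀ ht0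
  have hd : deriv (fun t => l t • vecSeries (holCoeff a) t + vecSeries (logCoeff a) t) t
      = _ := hR.deriv
  refine ⟨hR.differentiableAt, ?_, ?_, ?_⟩ <;> rw [hd] <;>
    simp only [Pi.add_apply, Pi.smul_apply, smul_eq_mul]
  · linear_combination l t * q1 + e1 + vecSeries (holCoeff a) t 0 * hcancel
  · linear_combination l t * q2 + e2 + ((1 - (a : 𝕜)) * vecSeries (holCoeff a) t 0
      + 2 * (a : 𝕜) * vecSeries (holCoeff a) t 1) * hcancel
  · linear_combination l t * q3 + e3 + (((a : 𝕜) - 2) * vecSeries (holCoeff a) t 0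
      + (2 - 2 * (a : 𝕜)) * vecSeries (holCoeff a) t 1
      + (a : 𝕜) * vecSeries (holCoeff a) t 2) * hcancel

/-! ### The polynomial solution and the Wronskian. -/

/-- The coefficients of a polynomial solution, proportional to `linP` if `a ≠ 0`. -/
def polyCoeff (a : ℝ) : ℕ → Fin 3 → ℝ
  | 0 => ![8 / 3 * a ^ 2 * (a - 1), 2 / 3 * a * (3 + 2 * a - a ^ 2),
      (a - 1) * (3 + 2 * a - a ^ 2)]
  | 1 => ![0, 0, 8 / 9 * a ^ 2]
  | _ + 2 => 0

/-- A polynomial solution, proportional to `linP` if `a ≠ 0`. -/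
def polySol (a : ℝ) (t : 𝕜) : Fin 3 → 𝕜 :=
  ![8 / 3 * (a : 𝕜) ^ 2 * ((a : 𝕜) - 1), 2 / 3 * (a : 𝕜) * (3 + 2 * (a : 𝕜) - (a : 𝕜) ^ 2),
    ((a : 𝕜) - 1) * (3 + 2 * (a : 𝕜) - (a : 𝕜) ^ 2) + 8 / 9 * (a : 𝕜) ^ 2 * t]

theorem hasSum_polyCoeff (a : ℝ) (t : 𝕜) (i : Fin 3) :
    HasSum (fun n => (polyCoeff a n i : 𝕜) * t ^ n) (polySol a t i) := by
  have : polySol a t i = ∑ n ∈ Finset.range 2, (polyCoeff a n i : 𝕜) * t ^ n := by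
    rw [Finset.sum_range_succ, Finset.sum_range_one]
    fin_cases i <;> simp only [polySol, polyCoeff, Fin.zero_eta, Fin.mk_one, Fin.reduceFinMk,
      Matrix.cons_val] <;> push_cast <;> ring
  rw [this]
  refine hasSum_sum_of_ne_finset_zero fun n hn => ?_
  obtain ⟨m, rfl⟩ : ∃ m, n = m + 2 := ⟨n - 2, by simp at hn; omega⟩
  simp [polyCoeff]

theorem isPFSolution_polySol (a : ℝ) (U : Set 𝕜) : IsPFSolution a U (polySol a) := by
  intro t _
  have hd : HasDerivAt (polySol a : 𝕜 → Fin 3 → 𝕜) ![0, 0, 8 / 9 * (a : 𝕜) ^ 2] t := by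
    rw [hasDerivAt_pi]
    intro i
    fin_cases i
    · exact hasDerivAt_const _ _
    · exact hasDerivAt_const _ _
    · exact (((hasDerivAt_id t).const_mul (8 / 9 * (a : 𝕜) ^ 2)).const_add _).congr_deriv
        (by simp)
  rw [hd.deriv]
  refine ⟨hd.differentiableAt, ?_, ?_, ?_⟩ <;> simp only [polySol, Matrix.cons_val] <;> ring

/-- Clearing the denominators of P gives a solution that survives at a = 0, a value allowed in (ii).
-/
theorem linP_eq {a : ℝ} (ha : a ≠ 0) :
    (linP a : 𝕜 → Fin 3 → 𝕜) = fun t => (9 / (8 * (a : 𝕜) ^ 2)) • polySol a t := by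
  have ha' : (a : 𝕜) ≠ 0 := by exact_mod_cast ha
  ext t i
  fin_cases i <;> simp [linP, polySol] <;> field_simp <;> ring

theorem IsPFSolution.const_smul {a : ℝ} {U : Set 𝕜} {J : 𝕜 → Fin 3 → 𝕜} (h : IsPFSolution a U J)
    (c : 𝕜) : IsPFSolution a U (fun t => c • J t) := by
  intro t ht
  obtain ⟨hd, h1, h2, h3⟩ := h t ht
  have hd' : deriv (fun t => c • J t) t = c • deriv J t := deriv_const_smul c hd
  refine ⟨hd.const_smul c, ?_, ?_, ?_⟩ <;> rw [hd'] <;>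
    simp only [Pi.smul_apply, smul_eq_mul]
  · linear_combination c * h1
  · linear_combination c * h2
  · linear_combination c * h3

/-- The determinant of the polynomial solution, the holomorphic solution and the holomorphic part
of the logarithmic solution. -/
def wronskian (a : ℝ) (t : 𝕜) : 𝕜 :=
  (solMatrix ![polySol a, vecSeries (holCoeff a), vecSeries (logCoeff a)] t).det

theorem vecSeries_zero (c : ℕ → Fin 3 → ℝ) (i : Fin 3) :
    vecSeries c (0 : 𝕜) i = (c 0 i : 𝕜) := by
  simp only [vecSeries]
  rw [tsum_eq_single 0 fun n hn => by simp [hn]]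
  simp

/-- At 0 the middle column is (1,0,0), and the remaining minor is a multiple of the left side of
`logCoeff_zero_eq`. -/
theorem wronskian_zero (a : ℝ) : wronskian a (0 : 𝕜)
    = -(2 / 3 * (3 + 2 * (a : 𝕜) - (a : 𝕜) ^ 2) * ((a : 𝕜) - 2)) := by
  have h := logCoeff_zero_eq a
  have h' : 3 / 2 * (1 - (a : 𝕜)) * (logCoeff a 0 1 : 𝕜) + (a : 𝕜) * (logCoeff a 0 2 : 𝕜)
      = (a : 𝕜) - 2 := by
    have := congrArg (fun x : ℝ => (x : 𝕜)) h
    push_cast at this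
    exact this
  simp only [wronskian, Matrix.det_fin_three, solMatrix, Matrix.of_apply, Matrix.cons_val,
    vecSeries_zero, polySol]
  simp only [holCoeff, pfSeries, Matrix.cons_val, RCLike.ofReal_one, RCLike.ofReal_zero]
  linear_combination (-(2 / 3 * (3 + 2 * (a : 𝕜) - (a : 𝕜) ^ 2))) * h'

theorem exists_radius (𝕜 : Type) [RCLike 𝕜] {a K : ℝ} (ha1 : a ≠ -1) (ha2 : a ≠ 2) (ha3 : a ≠ 3)
    (hK : GeomBound K (holCoeff a)) (hL : GeomBound K (logCoeff a)) :
    ∃ r : ℝ, 0 < r ∧ ∀ t : 𝕜, ‖t‖ < r →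
      K * ‖t‖ < 1 ∧ wronskian a t ≠ 0 ∧ pfDelta a t ≠ 0 := by
  have hD : (3 + 2 * (a : 𝕜) - (a : 𝕜) ^ 2) ≠ 0 := by exact_mod_cast quadratic_ne_zero ha1 ha3
  have h2 : (a : 𝕜) - 2 ≠ 0 := by exact_mod_cast sub_ne_zero.2 ha2
  have h4 : 4 - 2 * (a : 𝕜) ≠ 0 := fun h => h2 (by linear_combination -h / 2)
  have hK0 : K * ‖(0 : 𝕜)‖ < 1 := by simp
  have e1 : ∀ᶠ t : 𝕜 in nhds 0, K * ‖t‖ < 1 :=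
    (continuous_const.mul continuous_norm).continuousAt.eventually (gt_mem_nhds hK0)
  have e2 : ∀ᶠ t : 𝕜 in nhds 0, wronskian a t ≠ 0 := by
    have hc : ContinuousAt (wronskian a : 𝕜 → 𝕜) 0 := by
      refine (differentiableAt_det_fin_three fun i j => ?_).continuousAt
      fin_cases j
      · exact differentiableAt_pi.1 (isPFSolution_polySol (𝕜 := 𝕜) a univ 0 (mem_univ _)).1 i
      · exact differentiableAt_pi.1 (hK.hasDerivAt hK0).1.differentiableAt i
      · exact differentiableAt_pi.1 (hL.hasDerivAt hK0).1.differentiableAt i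
    refine hc.eventually_ne ?_
    rw [wronskian_zero]
    exact neg_ne_zero.2 (mul_ne_zero (mul_ne_zero (by norm_num) hD) h2)
  have e3 : ∀ᶠ t : 𝕜 in nhds 0, pfDelta a t ≠ 0 := by
    have hc : Continuous (pfDelta a : 𝕜 → 𝕜) := by unfold pfDelta; fun_prop
    refine hc.continuousAt.eventually_ne ?_
    have : pfDelta a (0 : 𝕜)
        = (4 - 2 * (a : 𝕜)) * (3 + 2 * (a : 𝕜) - (a : 𝕜) ^ 2) * ((a : 𝕜) - 2) := by
      simp only [pfDelta]; ring
    rw [this]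
    exact mul_ne_zero (mul_ne_zero h4 hD) h2
  obtain ⟨r, hr, h⟩ := Metric.eventually_nhds_iff.1 (e1.and (e2.and e3))
  exact ⟨r, hr, fun t ht => h (by simpa using ht)⟩

/-- The multiple of Q in the last column does not affect the determinant. The scale `κ` serves both
uses: 9/(8a²) yields P, and 1 covers every a. -/
theorem isPFFundamental_log {a K : ℝ} (ha1 : a ≠ -1) (ha2 : a ≠ 2) (ha3 : a ≠ 3)
    (hK : GeomBound K (holCoeff a)) (hL : GeomBound K (logCoeff a)) {r : ℝ}
    (hr : ∀ t : 𝕜, ‖t‖ < r → K * ‖t‖ < 1 ∧ wronskian a t ≠ 0 ∧ pfDelta a t ≠ 0)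
    {U : Set 𝕜} (hUo : IsOpen U) (hUc : IsConnected U) {l : 𝕜 → 𝕜}
    (hU : ∀ t ∈ U, ‖t‖ < r ∧ t ≠ 0 ∧ HasDerivAt l t⁻¹ t) {κ : 𝕜} (hκ : κ ≠ 0) :
    IsPFFundamental a U ![fun t => κ • polySol a t, vecSeries (holCoeff a),
      fun t => l t • vecSeries (holCoeff a) t + vecSeries (logCoeff a) t] := by
  refine isPFFundamental_of_det_ne_zero hUo hUc ?_ ?_ fun t ht =>
    ⟨(hU t ht).2.1, (hr t (hU t ht).1).2.2⟩
  · intro k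
    fin_cases k
    · exact (isPFSolution_polySol a U).const_smul κ
    · exact isPFSolution_holCoeff ha1 ha2 ha3 hK fun t ht => (hr t (hU t ht).1).1
    · exact isPFSolution_log ha1 ha2 ha3 hK hL fun t ht =>
        ⟨(hr t (hU t ht).1).1, (hU t ht).2⟩
  · intro t ht
    have h := (hr t (hU t ht).1).2.1
    have : (solMatrix ![fun t => κ • polySol a t, vecSeries (holCoeff a),
      fun t => l t • vecSeries (holCoeff a) t + vecSeries (logCoeff a) t] t).det
        = κ * wronskian a t := by
      simp only [wronskian, Matrix.det_fin_three, solMatrix, Matrix.of_apply, Matrix.cons_val,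
        Pi.add_apply, Pi.smul_apply, smul_eq_mul]
      ring
    rw [this]
    exact mul_ne_zero hκ h

/-! ### The first coefficients of Q. -/

theorem holCoeff_zero (a : ℝ) : holCoeff a 0 = ![1, 0, 0] := rfl

theorem holCoeff_one {a : ℝ} (ha1 : a ≠ -1) (ha2 : a ≠ 2) (ha3 : a ≠ 3) :
    holCoeff a 1 = -![(a - 1) / (12 * (a - 2) ^ 2), 1 / (6 * (a - 2)), 0] := by
  have h1 : a + 1 ≠ 0 := fun h => ha1 (by linarith)
  have h3 : 3 - a ≠ 0 := fun h => ha3 (by linarith)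
  have hD : 3 + 2 * a - a ^ 2 = (a + 1) * (3 - a) := by ring
  have h2 : a - 2 ≠ 0 := sub_ne_zero.2 ha2
  have h4 : 4 - 2 * a = (-2) * (a - 2) := by ring
  have h : holCoeff a 1 = pfStep a 0 (holCoeff a 0) 0 0 := rfl
  rw [h, holCoeff_zero]
  ext i
  fin_cases i <;> simp [pfStep, h4, hD] <;> field_simp <;> ring

theorem holCoeff_two {a : ℝ} (ha1 : a ≠ -1) (ha2 : a ≠ 2) (ha3 : a ≠ 3) :
    holCoeff a 2 = -![(11 * a ^ 2 - 22 * a + 15) / (576 * (a - 2) ^ 4),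
      (a - 1) / (48 * (a - 2) ^ 3), 1 / (72 * (a - 2) ^ 2)] := by
  have h1 : a + 1 ≠ 0 := fun h => ha1 (by linarith)
  have h3 : 3 - a ≠ 0 := fun h => ha3 (by linarith)
  have hD : 3 + 2 * a - a ^ 2 = (a + 1) * (3 - a) := by ring
  have h2 : a - 2 ≠ 0 := sub_ne_zero.2 ha2
  have h4 : 4 - 2 * a = (-2) * (a - 2) := by ring
  have h : holCoeff a 2 = pfStep a 1 (holCoeff a 1) 0 0 := rfl
  rw [h, holCoeff_one ha1 ha2 ha3]
  ext i
  fin_cases i <;> simp [pfStep, h4, hD] <;> field_simp <;> ring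

theorem holCoeff_three {a : ℝ} (ha1 : a ≠ -1) (ha2 : a ≠ 2) (ha3 : a ≠ 3) :
    holCoeff a 3 = -![35 * (a - 1) * (5 * a ^ 2 - 10 * a + 9) / (20736 * (a - 2) ^ 6),
      (85 * a ^ 2 - 170 * a + 105) / (10368 * (a - 2) ^ 5),
      5 * (a - 1) / (864 * (a - 2) ^ 4)] := by
  have h1 : a + 1 ≠ 0 := fun h => ha1 (by linarith)
  have h3 : 3 - a ≠ 0 := fun h => ha3 (by linarith)
  have hD : 3 + 2 * a - a ^ 2 = (a + 1) * (3 - a) := by ring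
  have h2 : a - 2 ≠ 0 := sub_ne_zero.2 ha2
  have h4 : 4 - 2 * a = (-2) * (a - 2) := by ring
  have h : holCoeff a 3 = pfStep a 2 (holCoeff a 2) 0 0 := rfl
  rw [h, holCoeff_two ha1 ha2 ha3]
  ext i
  fin_cases i <;> simp [pfStep, h4, hD] <;> field_simp <;> ring

/-! ### The radial coordinate and its inverse. -/

/-- The radial coordinate on the `x`-axis: `radial a x ^ 2 = H(x, 0) - H(1, 0)`. -/
def radial (a x : ℝ) : ℝ := (x - 1) * √(a * (x - 1) + 3)

/-- The derivative of the radial coordinate. -/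
def radialDeriv (a x : ℝ) : ℝ := 3 * (a * (x - 1) + 2) / (2 * √(a * (x - 1) + 3))

section
variable {a : ℝ}

/-- The expression a(x-1)+2 is affine in x, with values 2-a and 2+2a at the ends of [0,3]. Its
positivity makes x = 1 the only critical point of H(·,0) there and the radial coordinate increasing.
-/
theorem neg_two_lt_mul (ha : -1 < a) (ha' : a < 2) {x : ℝ} (hx : x ∈ Icc (0 : ℝ) 3) :
    -2 < a * (x - 1) := by
  obtain ⟨h0, h3⟩ := hx
  rcases le_total 1 x with h | h
  · nlinarith [mul_nonneg (by linarith : 0 ≤ a + 1) (by linarith : 0 ≤ x - 1)]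
  · nlinarith [mul_nonneg (by linarith : 0 ≤ 2 - a) (by linarith : 0 ≤ 1 - x)]

theorem sqrt_slope_pos (ha : -1 < a) (ha' : a < 2) {x : ℝ} (hx : x ∈ Icc (0 : ℝ) 3) :
    0 < √(a * (x - 1) + 3) :=
  Real.sqrt_pos.2 (by linarith [neg_two_lt_mul ha ha' hx])

theorem radialDeriv_pos (ha : -1 < a) (ha' : a < 2) {x : ℝ} (hx : x ∈ Icc (0 : ℝ) 3) :
    0 < radialDeriv a x :=
  div_pos (by linarith [neg_two_lt_mul ha ha' hx]) (by linarith [sqrt_slope_pos ha ha' hx])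

theorem radial_sq (ha : -1 < a) (ha' : a < 2) {x : ℝ} (hx : x ∈ Icc (0 : ℝ) 3) :
    radial a x ^ 2 = (x - 1) ^ 2 * (a * (x - 1) + 3) := by
  rw [radial, mul_pow, Real.sq_sqrt (by linarith [neg_two_lt_mul ha ha' hx])]

theorem hamH_eq (ha : -1 < a) (ha' : a < 2) {x : ℝ} (hx : x ∈ Icc (0 : ℝ) 3) (y : ℝ) :
    hamH a x y = x * y ^ 2 + radial a x ^ 2 - (3 - a) := by
  rw [radial_sq ha ha' hx, hamH]; ring

theorem radial_mul_radialDeriv (ha : -1 < a) (ha' : a < 2) {x : ℝ} (hx : x ∈ Icc (0 : ℝ) 3) :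
    radial a x * radialDeriv a x = 3 / 2 * (x - 1) * (a * (x - 1) + 2) := by
  have := (sqrt_slope_pos ha ha' hx).ne'
  rw [radial, radialDeriv]
  generalize √(a * (x - 1) + 3) = s at *
  field_simp

theorem hasDerivAt_radial (ha : -1 < a) (ha' : a < 2) {x : ℝ} (hx : x ∈ Icc (0 : ℝ) 3) :
    HasDerivAt (radial a) (radialDeriv a x) x := by
  have hs := sqrt_slope_pos ha ha' hx
  have hpos : 0 < a * (x - 1) + 3 := by linarith [neg_two_lt_mul ha ha' hx]
  have h1 : HasDerivAt (fun x : ℝ => x - 1) 1 x := (hasDerivAt_id x).sub_const 1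
  have h2 := ((h1.const_mul a).add_const 3).sqrt hpos.ne'
  refine (h1.mul h2).congr_deriv ?_
  have hsq := Real.sq_sqrt hpos.le
  rw [radialDeriv]
  field_simp
  rw [hsq]; ring

theorem continuousOn_radial (ha : -1 < a) (ha' : a < 2) : ContinuousOn (radial a) (Icc 0 3) :=
  fun _ hx => (hasDerivAt_radial ha ha' hx).continuousAt.continuousWithinAt

theorem strictMonoOn_radial (ha : -1 < a) (ha' : a < 2) : StrictMonoOn (radial a) (Icc 0 3) := by
  refine strictMonoOn_of_deriv_pos (convex_Icc 0 3) (continuousOn_radial ha ha') fun x hx => ?_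
  have hx' := interior_subset hx
  rw [(hasDerivAt_radial ha ha' hx').deriv]
  exact radialDeriv_pos ha ha' hx'

theorem continuousOn_radialDeriv (ha : -1 < a) (ha' : a < 2) :
    ContinuousOn (radialDeriv a) (Icc 0 3) := by
  unfold radialDeriv
  refine ContinuousOn.div (by fun_prop) (by fun_prop) fun x hx => ?_
  have := sqrt_slope_pos ha ha' hx
  positivity

theorem radial_zero (a : ℝ) : radial a 0 = -√(3 - a) := by
  rw [radial, show a * (0 - 1) + 3 = 3 - a by ring]; ring

/-- The inequality 4(2a+3) > 3-a amounts to a > -1. It puts the symmetric interval of radius √(3-a),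
which contains all the circles, inside the image of [0,3]. -/
theorem sqrt_lt_radial_three (ha : -1 < a) : √(3 - a) < radial a 3 := by
  have : radial a 3 = √(2 ^ 2 * (2 * a + 3)) := by
    rw [radial, Real.sqrt_mul (by norm_num), Real.sqrt_sq (by norm_num)]
    ring_nf
  rw [this]
  exact (Real.sqrt_lt_sqrt_iff_of_pos (by linarith)).2 (by linarith)

end

/-- Extending the inverse by constants through `projIcc` makes it continuous on all of ℝ. -/
theorem exists_continuous_leftInverse {f : ℝ → ℝ} {a b : ℝ} (hab : a ≤ b)
    (hc : ContinuousOn f (Icc a b)) (hm : StrictMonoOn f (Icc a b)) :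
    ∃ g : ℝ → ℝ, Continuous g ∧ (∀ x ∈ Icc a b, g (f x) = x) ∧
      ∀ u ∈ Icc (f a) (f b), g u ∈ Icc a b ∧ f (g u) = u := by
  have ha : a ∈ Icc a b := left_mem_Icc.2 hab
  have hb : b ∈ Icc a b := right_mem_Icc.2 hab
  have hfab : f a ≤ f b := hm.monotoneOn ha hb hab
  let F : Icc a b → Icc (f a) (f b) := fun x =>
    ⟨f x, hm.monotoneOn ha x.2 x.2.1, hm.monotoneOn x.2 hb x.2.2⟩
  have hF : StrictMono F := fun x y hxy => hm x.2 y.2 hxy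
  have hsurj : Function.Surjective F := by
    rintro ⟨u, hu⟩
    obtain ⟨x, hx, hxu⟩ := intermediate_value_Icc hab hc hu
    exact ⟨⟨x, hx⟩, Subtype.ext hxu⟩
  let e := hF.orderIsoOfSurjective F hsurj
  have he : ∀ x, e x = F x := fun x => rfl
  refine ⟨fun u => (e.symm (projIcc (f a) (f b) hfab u) : ℝ), ?_, fun x hx => ?_, fun u hu => ?_⟩
  · exact continuous_subtype_val.comp (e.symm.continuous.comp continuous_projIcc)
  · have : projIcc (f a) (f b) hfab (f x) = e ⟨x, hx⟩ := by
      rw [he]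
      exact projIcc_of_mem hfab (F ⟨x, hx⟩).2
    simp only [this, OrderIso.symm_apply_apply]
  · refine ⟨(e.symm _).2, ?_⟩
    have : (F (e.symm (projIcc (f a) (f b) hfab u)) : ℝ) = projIcc (f a) (f b) hfab u := by
      rw [← he, OrderIso.apply_symm_apply]
    rw [projIcc_of_mem hfab hu] at this
    simp only [projIcc_of_mem hfab hu]
    exact this

/-- `ξ` is a continuous inverse of the radial coordinate on `[0, 3]`. -/
structure IsRadialInv (a : ℝ) (ξ : ℝ → ℝ) : Prop where
  gt_neg_one : -1 < a
  lt_two : a < 2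
  continuous : Continuous ξ
  left_inv : ∀ x ∈ Icc (0 : ℝ) 3, ξ (radial a x) = x
  mem_Icc : ∀ u ∈ Icc (radial a 0) (radial a 3), ξ u ∈ Icc (0 : ℝ) 3
  right_inv : ∀ u ∈ Icc (radial a 0) (radial a 3), radial a (ξ u) = u

theorem exists_isRadialInv {a : ℝ} (ha : -1 < a) (ha' : a < 2) : ∃ ξ, IsRadialInv a ξ := by
  obtain ⟨ξ, h1, h2, h3⟩ := exists_continuous_leftInverse (by norm_num : (0 : ℝ) ≤ 3)
    (continuousOn_radial ha ha') (strictMonoOn_radial ha ha')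
  exact ⟨ξ, ha, ha', h1, h2, fun u hu => (h3 u hu).1, fun u hu => (h3 u hu).2⟩

namespace IsRadialInv
variable {a : ℝ} {ξ : ℝ → ℝ}

theorem Icc_subset (h : IsRadialInv a ξ) :
    Icc (-√(3 - a)) (√(3 - a)) ⊆ Icc (radial a 0) (radial a 3) :=
  Icc_subset_Icc (radial_zero a).le (sqrt_lt_radial_three h.gt_neg_one).le

theorem mem_Ioo (h : IsRadialInv a ξ) {u : ℝ} (hu : u ∈ Ioo (-√(3 - a)) √(3 - a)) :
    ξ u ∈ Ioo (0 : ℝ) 3 := by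
  have hI := h.Icc_subset (Ioo_subset_Icc_self hu)
  obtain ⟨h0, h3⟩ := h.mem_Icc u hI
  have hr := h.right_inv u hI
  refine ⟨lt_of_le_of_ne h0 fun e => ?_, lt_of_le_of_ne h3 fun e => ?_⟩
  · rw [← e, radial_zero] at hr; exact hu.1.ne hr
  · rw [e] at hr; exact (hu.2.trans (sqrt_lt_radial_three h.gt_neg_one)).ne' hr

theorem hasDerivAt (h : IsRadialInv a ξ) {u : ℝ} (hu : u ∈ Ioo (-√(3 - a)) √(3 - a)) :
    HasDerivAt ξ (radialDeriv a (ξ u))⁻¹ u := by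
  have hx := Ioo_subset_Icc_self (h.mem_Ioo hu)
  refine HasDerivAt.of_local_left_inverse h.continuous.continuousAt
    (hasDerivAt_radial h.gt_neg_one h.lt_two hx) (radialDeriv_pos h.gt_neg_one h.lt_two hx).ne' ?_
  filter_upwards [Ioo_mem_nhds hu.1 hu.2] with v hv
  exact h.right_inv v (h.Icc_subset (Ioo_subset_Icc_self hv))

/-- In the coordinates `u = radial a x`, `w = √x y` the level curves are circles. -/
theorem sub_sq_eq (h : IsRadialInv a ξ) {u t : ℝ} (hu : u ∈ Icc (-√(3 - a)) √(3 - a)) :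
    t + 3 - a - u ^ 2
      = t + ξ u * (-a * ξ u ^ 2 + 3 * (a - 1) * ξ u + 3 * (2 - a)) := by
  have hI := h.Icc_subset hu
  have := radial_sq h.gt_neg_one h.lt_two (h.mem_Icc u hI)
  rw [h.right_inv u hI] at this
  rw [this]; ring

theorem mul_radialDeriv (h : IsRadialInv a ξ) {u : ℝ} (hu : u ∈ Icc (-√(3 - a)) √(3 - a)) :
    u * radialDeriv a (ξ u) = 3 / 2 * (ξ u - 1) * (a * (ξ u - 1) + 2) := by
  have hI := h.Icc_subset hu
  have := radial_mul_radialDeriv h.gt_neg_one h.lt_two (h.mem_Icc u hI)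
  rwa [h.right_inv u hI] at this

end IsRadialInv

/-! ### The Abelian integrals in polar coordinates. -/

/-- The densities `x ^ (k - 1/2) dx / du`, for `k = -1, 0, 1`. -/
def radialDens (a : ℝ) (ξ : ℝ → ℝ) (k : Fin 3) (u : ℝ) : ℝ :=
  ![1 / (ξ u * √(ξ u)), 1 / √(ξ u), √(ξ u)] k * (radialDeriv a (ξ u))⁻¹

/-- The primitives of the densities `radialDens`. -/
def radialPrim (ξ : ℝ → ℝ) (k : Fin 3) (u : ℝ) : ℝ :=
  ![-2 / √(ξ u), 2 * √(ξ u), 2 / 3 * (ξ u * √(ξ u))] k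

section
variable {a : ℝ} {ξ : ℝ → ℝ}

theorem hasDerivAt_radialPrim (h : IsRadialInv a ξ) (k : Fin 3) {u : ℝ}
    (hu : u ∈ Ioo (-√(3 - a)) √(3 - a)) :
    HasDerivAt (radialPrim ξ k) (radialDens a ξ k u) u := by
  have hx := (h.mem_Ioo hu).1
  have hd := h.hasDerivAt hu
  have hs := hd.sqrt hx.ne'
  have hs0 : √(ξ u) ≠ 0 := (Real.sqrt_pos.2 hx).ne'
  have hsq : √(ξ u) ^ 2 = ξ u := Real.sq_sqrt hx.le
  fin_cases k
  · refine ((hasDerivAt_const u (-2 : ℝ)).div hs hs0).congr_deriv ?_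
    simp only [radialDens, Fin.zero_eta, Matrix.cons_val]
    rw [hsq]; field_simp; ring
  · refine (hs.const_mul 2).congr_deriv ?_
    simp only [radialDens, Fin.mk_one, Matrix.cons_val]
    field_simp
  · refine ((hd.mul hs).const_mul (2 / 3)).congr_deriv ?_
    simp only [radialDens, Fin.reduceFinMk, Matrix.cons_val]
    generalize (radialDeriv a (ξ u))⁻¹ = R
    generalize √(ξ u) = s at *
    rw [← hsq]; field_simp; ring

theorem continuousOn_radialDens (h : IsRadialInv a ξ) (k : Fin 3) :
    ContinuousOn (radialDens a ξ k) (Ioo (-√(3 - a)) √(3 - a)) := by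
  have hc : ContinuousOn ξ (Ioo (-√(3 - a)) √(3 - a)) := h.continuous.continuousOn
  have hsq : ContinuousOn (fun u => √(ξ u)) (Ioo (-√(3 - a)) √(3 - a)) := hc.sqrt
  have hR : ContinuousOn (fun u => (radialDeriv a (ξ u))⁻¹) (Ioo (-√(3 - a)) √(3 - a)) := by
    refine ContinuousOn.inv₀ ((continuousOn_radialDeriv h.gt_neg_one h.lt_two).comp hc
      fun u hu => Ioo_subset_Icc_self (h.mem_Ioo hu)) fun u hu =>
      (radialDeriv_pos h.gt_neg_one h.lt_two (Ioo_subset_Icc_self (h.mem_Ioo hu))).ne'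
  have hx : ∀ u ∈ Ioo (-√(3 - a)) √(3 - a), 0 < ξ u := fun u hu => (h.mem_Ioo hu).1
  have hs0 : ∀ u ∈ Ioo (-√(3 - a)) √(3 - a), √(ξ u) ≠ 0 := fun u hu =>
    (Real.sqrt_pos.2 (hx u hu)).ne'
  unfold radialDens
  refine ContinuousOn.mul ?_ hR
  fin_cases k
  · exact continuousOn_const.div (hc.mul hsq) fun u hu => mul_ne_zero (hx u hu).ne' (hs0 u hu)
  · exact continuousOn_const.div hsq hs0
  · exact hsq

theorem mul_cos_mem {ρ R : ℝ} (hρ : |ρ| < R) (θ : ℝ) : ρ * Real.cos θ ∈ Ioo (-R) R := by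
  rw [mem_Ioo, ← abs_lt, abs_mul]
  exact (mul_le_of_le_one_right (abs_nonneg _) (Real.abs_cos_le_one θ)).trans_lt hρ

theorem continuous_comp_mul_cos {E : ℝ → ℝ} {ρ R : ℝ} (hE : ContinuousOn E (Ioo (-R) R))
    (hρ : |ρ| < R) : Continuous fun θ => E (ρ * Real.cos θ) :=
  hE.comp_continuous (by fun_prop) (mul_cos_mem hρ)

/-- The integrand is the derivative of E(ρ cos θ) ρ sin θ, which vanishes at 0 and π. -/
theorem integral_circle_eq_zero {E E' : ℝ → ℝ} {ρ R : ℝ}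
    (hE : ∀ u ∈ Ioo (-R) R, HasDerivAt E (E' u) u) (hE' : ContinuousOn E' (Ioo (-R) R))
    (hρ : |ρ| < R) :
    ∫ θ in (0 : ℝ)..π, (E (ρ * Real.cos θ) * (ρ * Real.cos θ)
      - E' (ρ * Real.cos θ) * (ρ ^ 2 * Real.sin θ ^ 2)) = 0 := by
  have c1 := continuous_comp_mul_cos
    (fun u hu => (hE u hu).continuousAt.continuousWithinAt : ContinuousOn E (Ioo (-R) R)) hρ
  have c2 := continuous_comp_mul_cos hE' hρ
  have key : ∀ θ : ℝ, HasDerivAt (fun θ => E (ρ * Real.cos θ) * (ρ * Real.sin θ))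
      (E (ρ * Real.cos θ) * (ρ * Real.cos θ)
        - E' (ρ * Real.cos θ) * (ρ ^ 2 * Real.sin θ ^ 2)) θ := by
    intro θ
    have h1 := (hE _ (mul_cos_mem hρ θ)).comp θ ((Real.hasDerivAt_cos θ).const_mul ρ)
    refine (h1.mul ((Real.hasDerivAt_sin θ).const_mul ρ)).congr_deriv ?_
    simp only [Function.comp]; ring
  rw [intervalIntegral.integral_eq_sub_of_hasDerivAt (fun θ _ => key θ)
    (((c1.mul (by fun_prop)).sub (c2.mul (by fun_prop))).intervalIntegrable _ _)]
  simp

theorem hasDerivAt_integral_circle {E E' : ℝ → ℝ} {ρ R : ℝ}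
    (hE : ∀ u ∈ Ioo (-R) R, HasDerivAt E (E' u) u) (hE' : ContinuousOn E' (Ioo (-R) R))
    (hρ : |ρ| < R) :
    HasDerivAt (fun ρ => ∫ θ in (0 : ℝ)..π, E (ρ * Real.cos θ) * Real.cos θ)
      (∫ θ in (0 : ℝ)..π, E' (ρ * Real.cos θ) * Real.cos θ ^ 2) ρ := by
  obtain ⟨R₁, hρ₁, hR₁⟩ := exists_between hρ
  have hEc : ContinuousOn E (Ioo (-R) R) := fun u hu => (hE u hu).continuousAt.continuousWithinAt
  obtain ⟨C, hC⟩ := (isCompact_Icc (a := -R₁) (b := R₁)).exists_bound_of_continuousOn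
    (hE'.mono (Icc_subset_Ioo (by linarith) hR₁))
  have hs : {x : ℝ | |x| < R₁} ∈ nhds ρ :=
    (isOpen_lt continuous_abs continuous_const).mem_nhds hρ₁
  have hcont : ∀ x, |x| < R₁ → Continuous fun θ => E (x * Real.cos θ) * Real.cos θ :=
    fun x hx => (continuous_comp_mul_cos hEc (hx.trans hR₁)).mul Real.continuous_cos
  refine (intervalIntegral.hasDerivAt_integral_of_dominated_loc_of_deriv_le
    (F := fun x θ => E (x * Real.cos θ) * Real.cos θ)
    (F' := fun x θ => E' (x * Real.cos θ) * Real.cos θ ^ 2) (bound := fun _ => C) hs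
    ?_ ?_ ?_ ?_ ?_ ?_).2
  · filter_upwards [hs] with x hx
    exact (hcont x hx).aestronglyMeasurable
  · exact (hcont ρ hρ₁).intervalIntegrable _ _
  · exact ((continuous_comp_mul_cos hE' hρ).mul
      (Real.continuous_cos.pow 2)).aestronglyMeasurable
  · refine Filter.Eventually.of_forall fun θ _ x hx => ?_
    have h1 := hC _ (Ioo_subset_Icc_self (mul_cos_mem hx θ))
    rw [norm_mul]
    refine (mul_le_of_le_one_right (norm_nonneg _) ?_).trans h1
    rw [norm_pow]
    exact pow_le_one₀ (norm_nonneg _) (Real.abs_cos_le_one θ)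
  · exact intervalIntegrable_const
  · refine Filter.Eventually.of_forall fun θ _ x hx => ?_
    have h1 := (hE _ (mul_cos_mem (hx.trans hR₁) θ)).comp x
      ((hasDerivAt_id x).mul_const (Real.cos θ))
    refine (h1.mul_const (Real.cos θ)).congr_deriv ?_
    ring

/-- The Abelian integrals in polar coordinates. -/
def abelInt (a : ℝ) (ξ : ℝ → ℝ) (t : ℝ) (k : Fin 3) : ℝ :=
  2 * ∫ θ in (0 : ℝ)..π,
    radialDens a ξ k (√(t + 3 - a) * Real.cos θ) * (√(t + 3 - a) ^ 2 * Real.sin θ ^ 2)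

theorem abs_sqrt_lt {t : ℝ} (ht : t ∈ Ioo (a - 3) 0) : |√(t + 3 - a)| < √(3 - a) := by
  rw [abs_of_nonneg (Real.sqrt_nonneg _)]
  exact Real.sqrt_lt_sqrt (by linarith [ht.1]) (by linarith [ht.2])

/-- Integration by parts passes to the primitive of the density, so that differentiating in ρ
requires only continuity of the density. -/
theorem integral_radialPrim (h : IsRadialInv a ξ) (k : Fin 3) {ρ : ℝ} (hρ : |ρ| < √(3 - a)) :
    ∫ θ in (0 : ℝ)..π, radialDens a ξ k (ρ * Real.cos θ) * (ρ ^ 2 * Real.sin θ ^ 2)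
      = ρ * ∫ θ in (0 : ℝ)..π, radialPrim ξ k (ρ * Real.cos θ) * Real.cos θ := by
  have c1 := continuous_comp_mul_cos (fun u hu =>
    (hasDerivAt_radialPrim h k hu).continuousAt.continuousWithinAt) hρ
  have c2 := continuous_comp_mul_cos (continuousOn_radialDens h k) hρ
  have := integral_circle_eq_zero (fun u hu => hasDerivAt_radialPrim h k hu)
    (continuousOn_radialDens h k) hρ
  rw [intervalIntegral.integral_sub (Continuous.intervalIntegrable (by fun_prop) _ _)
    (Continuous.intervalIntegrable (by fun_prop) _ _), sub_eq_zero] at this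
  rw [← this, ← intervalIntegral.integral_const_mul]
  congr 1; ext θ; ring

theorem abelInt_eq (h : IsRadialInv a ξ) {t : ℝ} (ht : t ∈ Ioo (a - 3) 0) (k : Fin 3) :
    abelInt a ξ t k = 2 * (√(t + 3 - a) *
      ∫ θ in (0 : ℝ)..π, radialPrim ξ k (√(t + 3 - a) * Real.cos θ) * Real.cos θ) := by
  rw [abelInt, integral_radialPrim h k (abs_sqrt_lt ht)]

/-- The product rule applied to ρ∫E cos θ gives ∫E cos θ + ρ∫E' cos²θ. Integration by parts turns
the first term into ρ∫E' sin²θ, and the sum ρ∫E' meets dρ/dt = 1/(2ρ). -/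
theorem hasDerivAt_abelInt (h : IsRadialInv a ξ) {t : ℝ} (ht : t ∈ Ioo (a - 3) 0) (k : Fin 3) :
    HasDerivAt (fun t => abelInt a ξ t k)
      (∫ θ in (0 : ℝ)..π, radialDens a ξ k (√(t + 3 - a) * Real.cos θ)) t := by
  have hpos : 0 < t + 3 - a := by linarith [ht.1]
  have hρ := abs_sqrt_lt ht
  have h1 := hasDerivAt_integral_circle (fun u hu => hasDerivAt_radialPrim h k hu)
    (continuousOn_radialDens h k) hρ
  have h2 := ((hasDerivAt_id (√(t + 3 - a))).mul h1).const_mul 2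
  have h3 : HasDerivAt (fun t : ℝ => √(t + 3 - a)) (1 / (2 * √(t + 3 - a))) t :=
    (((hasDerivAt_id t).add_const 3).sub_const a).sqrt hpos.ne'
  have h4 := (h2.comp t h3).congr_of_eventuallyEq (f₁ := fun t => abelInt a ξ t k) (by
    filter_upwards [Ioo_mem_nhds ht.1 ht.2] with s hs
    simpa using abelInt_eq h hs k)
  refine h4.congr_deriv ?_
  have hs : √(t + 3 - a) ≠ 0 := (Real.sqrt_pos.2 hpos).ne'
  have e := integral_radialPrim h k hρ
  have c2 := continuous_comp_mul_cos (continuousOn_radialDens h k) hρ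
  generalize √(t + 3 - a) = ρ at *
  have split : ∫ θ in (0 : ℝ)..π, radialDens a ξ k (ρ * Real.cos θ)
      = (∫ θ in (0 : ℝ)..π, radialDens a ξ k (ρ * Real.cos θ) * Real.cos θ ^ 2)
        + (1 / ρ ^ 2) * ∫ θ in (0 : ℝ)..π,
          radialDens a ξ k (ρ * Real.cos θ) * (ρ ^ 2 * Real.sin θ ^ 2) := by
    rw [← intervalIntegral.integral_const_mul, ← intervalIntegral.integral_add
      (Continuous.intervalIntegrable (by fun_prop) _ _)
      (Continuous.intervalIntegrable (by fun_prop) _ _)]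
    congr 1; ext θ
    rw [Real.cos_sq']; field_simp; ring
  rw [split, e]
  simp only [id, one_mul]
  field_simp
  ring

end

/-! ### The Picard–Fuchs system and the limit at t = 0 for the Abelian integrals. -/

section
variable {a : ℝ} {ξ : ℝ → ℝ}

/-- On the circle w = ρ² sin²θ, so `d k` integrates to J_k', `d k * w` to J_k/2 and `p k` to 0. Each
equation of (1) thus holds before integration, up to a combination of the exact terms `p k`. -/
theorem radialDens_identities (h : IsRadialInv a ξ) {u t : ℝ}
    (hu : u ∈ Ioo (-√(3 - a)) √(3 - a)) :
    let d := fun k => radialDens a ξ k u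
    let w := t + 3 - a - u ^ 2
    let p := fun k => radialPrim ξ k u * u - d k * w
    (t * d 0 + (4 - 2 * a) * d 1 + (a - 1) * d 2 - 2 / 3 * (d 0 * w) + 1 / 3 * p 0 = 0) ∧
    ((1 - a) * t * d 0 + 2 * a * t * d 1 + (3 + 2 * a - a ^ 2) * d 2 - 8 / 3 * a * (d 1 * w)
      + (1 - a) * p 0 - 2 / 3 * a * p 1 = 0) ∧
    ((a - 2) * t * d 0 + (2 - 2 * a) * t * d 1 + a * t * d 2
      - 3 * (1 - a) * (d 1 * w) - 2 * a * (d 2 * w)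
      + (a - 2) * p 0 + (a - 1) * p 1 - a * p 2 = 0) := by
  have hx := (h.mem_Ioo hu).1
  have hR := radialDeriv_pos h.gt_neg_one h.lt_two (Ioo_subset_Icc_self (h.mem_Ioo hu))
  have hw := h.sub_sq_eq (t := t) (Ioo_subset_Icc_self hu)
  have hm := h.mul_radialDeriv (Ioo_subset_Icc_self hu)
  have hu' : u = 3 / 2 * (ξ u - 1) * (a * (ξ u - 1) + 2) * (radialDeriv a (ξ u))⁻¹ := by
    rw [← hm]; field_simp
  have hs := Real.sqrt_pos.2 hx
  have hsq : √(ξ u) ^ 2 = ξ u := Real.sq_sqrt hx.le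
  intro d w p
  simp only [d, p, w, hw, radialDens, radialPrim, Matrix.cons_val]
  generalize (radialDeriv a (ξ u))⁻¹ = I at *
  generalize √(ξ u) = s at *
  generalize ξ u = x at *
  subst hsq
  rw [hu']
  refine ⟨?_, ?_, ?_⟩ <;> field_simp <;> ring

theorem abelInt_linear_relation (h : IsRadialInv a ξ) {t : ℝ} (ht : t ∈ Ioo (a - 3) 0)
    (α β γ : Fin 3 → ℝ)
    (hrel : ∀ u ∈ Ioo (-√(3 - a)) √(3 - a), ∑ k, (α k * radialDens a ξ k u
      + β k * (radialDens a ξ k u * (t + 3 - a - u ^ 2))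
      + γ k * (radialPrim ξ k u * u - radialDens a ξ k u * (t + 3 - a - u ^ 2))) = 0) :
    ∑ k, (α k * (∫ θ in (0 : ℝ)..π, radialDens a ξ k (√(t + 3 - a) * Real.cos θ))
      + β k * (abelInt a ξ t k / 2)) = 0 := by
  have hpos : 0 < t + 3 - a := by linarith [ht.1]
  have hρ := abs_sqrt_lt ht
  have hsq := Real.sq_sqrt hpos.le
  simp only [abelInt]
  generalize √(t + 3 - a) = ρ at *
  have c1 := fun k => continuous_comp_mul_cos (continuousOn_radialDens h k) hρ
  have c2 := fun k => continuous_comp_mul_cos (fun u hu =>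
    (hasDerivAt_radialPrim h k hu).continuousAt.continuousWithinAt) hρ
  have c3 : Continuous fun θ => ρ ^ 2 * Real.sin θ ^ 2 := by fun_prop
  have c4 : Continuous fun θ => ρ * Real.cos θ := by fun_prop
  have i1 : ∀ k, IntervalIntegrable (fun θ => α k * radialDens a ξ k (ρ * Real.cos θ))
      MeasureTheory.volume 0 π := fun k => ((c1 k).const_mul _).intervalIntegrable _ _
  have i2 : ∀ k, IntervalIntegrable (fun θ => β k * (radialDens a ξ k (ρ * Real.cos θ)
      * (ρ ^ 2 * Real.sin θ ^ 2))) MeasureTheory.volume 0 π :=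
    fun k => (((c1 k).mul c3).const_mul _).intervalIntegrable _ _
  have i3 : ∀ k, IntervalIntegrable (fun θ => γ k * (radialPrim ξ k (ρ * Real.cos θ)
      * (ρ * Real.cos θ) - radialDens a ξ k (ρ * Real.cos θ) * (ρ ^ 2 * Real.sin θ ^ 2)))
      MeasureTheory.volume 0 π :=
    fun k => ((((c2 k).mul c4).sub ((c1 k).mul c3)).const_mul _).intervalIntegrable _ _
  have hzero : ∫ θ in (0 : ℝ)..π, ∑ k, (α k * radialDens a ξ k (ρ * Real.cos θ)
      + β k * (radialDens a ξ k (ρ * Real.cos θ) * (ρ ^ 2 * Real.sin θ ^ 2))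
      + γ k * (radialPrim ξ k (ρ * Real.cos θ) * (ρ * Real.cos θ)
        - radialDens a ξ k (ρ * Real.cos θ) * (ρ ^ 2 * Real.sin θ ^ 2))) = 0 := by
    refine (intervalIntegral.integral_congr (g := fun _ => (0 : ℝ)) fun θ _ => ?_).trans (by simp)
    have := hrel _ (mul_cos_mem hρ θ)
    have e : t + 3 - a - (ρ * Real.cos θ) ^ 2 = ρ ^ 2 * Real.sin θ ^ 2 := by
      rw [Real.sin_sq, ← hsq]; ring
    rwa [e] at this
  rw [intervalIntegral.integral_finsetSum fun k _ => ((i1 k).add (i2 k)).add (i3 k)] at hzero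
  refine (Finset.sum_congr rfl fun k _ => ?_).trans hzero
  rw [intervalIntegral.integral_add ((i1 k).add (i2 k)) (i3 k),
    intervalIntegral.integral_add (i1 k) (i2 k), intervalIntegral.integral_const_mul,
    intervalIntegral.integral_const_mul, intervalIntegral.integral_const_mul,
    integral_circle_eq_zero (fun u hu => hasDerivAt_radialPrim h k hu)
      (continuousOn_radialDens h k) hρ]
  ring

theorem isPFSolution_abelInt (h : IsRadialInv a ξ) :
    IsPFSolution a (Ioo (a - 3) 0) (abelInt a ξ) := by
  intro t ht
  have hd : HasDerivAt (abelInt a ξ)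
      (fun k => ∫ θ in (0 : ℝ)..π, radialDens a ξ k (√(t + 3 - a) * Real.cos θ)) t :=
    hasDerivAt_pi.2 fun k => hasDerivAt_abelInt h ht k
  have e1 := abelInt_linear_relation h ht ![t, 4 - 2 * a, a - 1] ![-(2 / 3), 0, 0]
    ![1 / 3, 0, 0] fun u hu => by
      have := (radialDens_identities h (t := t) hu).1
      simp only [Fin.sum_univ_three, Matrix.cons_val] at this ⊢
      linarith
  have e2 := abelInt_linear_relation h ht ![(1 - a) * t, 2 * a * t, 3 + 2 * a - a ^ 2]
    ![0, -(8 / 3 * a), 0] ![1 - a, -(2 / 3 * a), 0] fun u hu => by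
      have := (radialDens_identities h (t := t) hu).2.1
      simp only [Fin.sum_univ_three, Matrix.cons_val] at this ⊢
      linarith
  have e3 := abelInt_linear_relation h ht ![(a - 2) * t, (2 - 2 * a) * t, a * t]
    ![0, -(3 * (1 - a)), -(2 * a)] ![a - 2, a - 1, -a] fun u hu => by
      have := (radialDens_identities h (t := t) hu).2.2
      simp only [Fin.sum_univ_three, Matrix.cons_val] at this ⊢
      linarith
  rw [hd.deriv]
  simp only [Fin.sum_univ_three, Matrix.cons_val] at e1 e2 e3
  simp only [RCLike.ofReal_real_eq_id, id]
  exact ⟨hd.differentiableAt, by linarith, by linarith, by linarith⟩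

/-- On the level t = 0 one has y² = f(x) with f' = -2(3/2(1-a) + ax). The combined integrand is
therefore exact and only the endpoint x = 0 contributes. -/
theorem tendsto_abelInt (h : IsRadialInv a ξ) :
    Filter.Tendsto (fun t => 3 / 2 * (1 - a) * abelInt a ξ t 1 + a * abelInt a ξ t 2)
      (nhdsWithin 0 (Iio 0)) (nhds (2 * (2 - a) * √(3 * (2 - a)))) := by
  have ha := h.gt_neg_one
  have ha' := h.lt_two
  set p : ℝ → ℝ := fun u => 3 / 2 * (1 - a) * radialPrim ξ 1 u + a * radialPrim ξ 2 u with hp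
  have hpc : Continuous p := by
    have := h.continuous
    simp only [hp, radialPrim, Matrix.cons_val]
    fun_prop
  have hk : ∀ k : Fin 3, k ≠ 0 → Continuous (radialPrim ξ k) := by
    intro k hk
    have := h.continuous
    fin_cases k
    · exact absurd rfl hk
    · exact (by fun_prop : Continuous fun u => 2 * √(ξ u))
    · exact (by fun_prop : Continuous fun u => 2 / 3 * (ξ u * √(ξ u)))
  -- After integration by parts the formula makes sense up to t = 0: the primitives for k = 0, 1
  -- stay continuous at x = 0, unlike that for k = -1.
  set G : ℝ → ℝ := fun t => 2 * (√(t + 3 - a) *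
    ∫ θ in (0 : ℝ)..π, p (√(t + 3 - a) * Real.cos θ) * Real.cos θ) with hG
  have hGc : Continuous G := by
    refine continuous_const.mul (Continuous.mul (by fun_prop) ?_)
    refine intervalIntegral.continuous_parametric_intervalIntegral_of_continuous' ?_ 0 π
    simp only [Function.uncurry_def]
    fun_prop
  have hGJ : G =ᶠ[nhdsWithin 0 (Iio 0)]
      fun t => 3 / 2 * (1 - a) * abelInt a ξ t 1 + a * abelInt a ξ t 2 := by
    filter_upwards [Ioo_mem_nhdsLT (by linarith : a - 3 < 0)] with t ht
    rw [abelInt_eq h ht, abelInt_eq h ht]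
    have i : ∀ k : Fin 3, k ≠ 0 → ∀ c : ℝ, IntervalIntegrable
        (fun θ => c * (radialPrim ξ k (√(t + 3 - a) * Real.cos θ) * Real.cos θ))
        MeasureTheory.volume 0 π := fun k hk0 c => by
      have := hk k hk0
      exact Continuous.intervalIntegrable (by fun_prop) _ _
    have : ∫ θ in (0 : ℝ)..π, p (√(t + 3 - a) * Real.cos θ) * Real.cos θ
        = 3 / 2 * (1 - a) * (∫ θ in (0 : ℝ)..π,
            radialPrim ξ 1 (√(t + 3 - a) * Real.cos θ) * Real.cos θ)
          + a * ∫ θ in (0 : ℝ)..π,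
            radialPrim ξ 2 (√(t + 3 - a) * Real.cos θ) * Real.cos θ := by
      rw [← intervalIntegral.integral_const_mul, ← intervalIntegral.integral_const_mul,
        ← intervalIntegral.integral_add (i 1 (by decide) _) (i 2 (by decide) _)]
      congr 1; ext θ; simp only [hp]; ring
    simp only [hG, this]
    ring
  have hG0 : G 0 = 2 * (2 - a) * √(3 * (2 - a)) := by
    have hpos : 0 < 3 - a := by linarith
    have hs := Real.sqrt_pos.2 hpos
    simp only [hG, zero_add]
    set f : ℝ → ℝ := fun x => -a * x ^ 2 + 3 * (a - 1) * x + 3 * (2 - a) with hf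
    have hmem : ∀ θ : ℝ, √(3 - a) * Real.cos θ ∈ Icc (-√(3 - a)) √(3 - a) := fun θ =>
      ⟨by nlinarith [Real.neg_one_le_cos θ], by nlinarith [Real.cos_le_one θ]⟩
    have hw : ∀ θ : ℝ, ξ (√(3 - a) * Real.cos θ) * f (ξ (√(3 - a) * Real.cos θ))
        = √(3 - a) ^ 2 * Real.sin θ ^ 2 := by
      intro θ
      have := h.sub_sq_eq (t := 0) (hmem θ)
      rw [zero_add, zero_add] at this
      rw [← this, Real.sin_sq, mul_pow, Real.sq_sqrt hpos.le]; ring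
    -- A primitive of the integrand: the first term undoes the integration by parts, the second is
    -- f^(3/2)/3. It is continuous on all of [0,π], while differentiability is needed only inside.
    set T : ℝ → ℝ := fun θ => p (√(3 - a) * Real.cos θ) * (√(3 - a) * Real.sin θ)
      + 1 / 3 * (f (ξ (√(3 - a) * Real.cos θ)) * √(f (ξ (√(3 - a) * Real.cos θ)))) with hT
    have hTc : Continuous T := by
      have := h.continuous
      simp only [hT, hf]; fun_prop
    have hTd : ∀ θ ∈ Ioo 0 π, HasDerivAt T
        (√(3 - a) * (p (√(3 - a) * Real.cos θ) * Real.cos θ)) θ := by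
      intro θ hθ
      have hsin := Real.sin_pos_of_mem_Ioo hθ
      have hcos : |Real.cos θ| < 1 := by
        rw [← sq_lt_one_iff_abs_lt_one, Real.cos_sq']; nlinarith
      have hu : √(3 - a) * Real.cos θ ∈ Ioo (-√(3 - a)) √(3 - a) := by
        rw [mem_Ioo, ← abs_lt, abs_mul, abs_of_pos hs]; nlinarith
      have hwθ := hw θ
      have hx := (h.mem_Ioo hu).1
      have hf0 : 0 < f (ξ (√(3 - a) * Real.cos θ)) := by
        have : 0 < √(3 - a) ^ 2 * Real.sin θ ^ 2 := by positivity
        rw [← hwθ] at this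
        exact pos_of_mul_pos_right this hx.le
      have hsf := Real.sqrt_pos.2 hf0
      have hsx := Real.sqrt_pos.2 hx
      have hroot : √(ξ (√(3 - a) * Real.cos θ)) * √(f (ξ (√(3 - a) * Real.cos θ)))
          = √(3 - a) * Real.sin θ := by
        rw [← Real.sqrt_mul hx.le, hwθ, ← mul_pow, Real.sqrt_sq (by positivity)]
      have dc : HasDerivAt (fun θ => √(3 - a) * Real.cos θ) (√(3 - a) * -Real.sin θ) θ :=
        (Real.hasDerivAt_cos θ).const_mul _
      have ds : HasDerivAt (fun θ => √(3 - a) * Real.sin θ) (√(3 - a) * Real.cos θ) θ :=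
        (Real.hasDerivAt_sin θ).const_mul _
      have d1 := (((hasDerivAt_radialPrim h 1 hu).const_mul (3 / 2 * (1 - a))).add
        ((hasDerivAt_radialPrim h 2 hu).const_mul a)).comp θ dc
      have dξ := (h.hasDerivAt hu).comp θ dc
      have df : HasDerivAt f (-a * (2 * ξ (√(3 - a) * Real.cos θ)) + 3 * (a - 1))
          (ξ (√(3 - a) * Real.cos θ)) :=
        ((((hasDerivAt_pow 2 _).const_mul (-a)).add
          ((hasDerivAt_id _).const_mul (3 * (a - 1)))).add_const (3 * (2 - a))).congr_deriv
          (by simp)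
      have dfξ := df.comp θ dξ
      have d2 := (dfξ.mul (dfξ.sqrt hf0.ne')).const_mul (1 / 3)
      refine ((d1.mul ds).add d2).congr_deriv ?_
      simp only [hp, Function.comp, Pi.add_apply, radialDens, radialPrim,
        Matrix.cons_val]
      have hsx2 := Real.sq_sqrt hx.le
      have hsf2 := Real.sq_sqrt hf0.le
      have hfx : f (ξ (√(3 - a) * Real.cos θ)) = -a * ξ (√(3 - a) * Real.cos θ) ^ 2
        + 3 * (a - 1) * ξ (√(3 - a) * Real.cos θ) + 3 * (2 - a) := rfl
      have hroot' : √(3 - a) * -Real.sin θ = -(√(ξ (√(3 - a) * Real.cos θ))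
        * √(f (ξ (√(3 - a) * Real.cos θ)))) := by rw [hroot]; ring
      rw [hroot', ← hroot]
      generalize √(f (ξ (√(3 - a) * Real.cos θ))) = y at *
      generalize f (ξ (√(3 - a) * Real.cos θ)) = z at *
      generalize √(ξ (√(3 - a) * Real.cos θ)) = v at *
      generalize ξ (√(3 - a) * Real.cos θ) = x at *
      generalize (radialDeriv a x)⁻¹ = I at *
      subst hsx2
      subst hsf2
      field_simp
      ring
    have hint : ∫ θ in (0 : ℝ)..π, √(3 - a) * (p (√(3 - a) * Real.cos θ) * Real.cos θ)
        = T π - T 0 :=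
      intervalIntegral.integral_eq_sub_of_hasDerivAt_of_le Real.pi_pos.le hTc.continuousOn hTd
        (Continuous.intervalIntegrable (by fun_prop) _ _)
    rw [← intervalIntegral.integral_const_mul, hint]
    have hπ : T π = 1 / 3 * (3 * (2 - a) * √(3 * (2 - a))) := by
      have : ξ (-√(3 - a)) = 0 := by
        rw [← radial_zero]; exact h.left_inv 0 (by norm_num)
      simp [hT, hf, this]
    have h0 : T 0 = 0 := by
      have hx0 : ξ √(3 - a) ≠ 0 := by
        intro e
        have := h.right_inv _ (h.Icc_subset (right_mem_Icc.2 (by linarith)))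
        rw [e, radial_zero] at this
        linarith
      have := hw 0
      simp only [Real.cos_zero, mul_one, Real.sin_zero, ne_eq, OfNat.ofNat_ne_zero,
        not_false_eq_true, zero_pow, mul_zero, mul_eq_zero, hx0, false_or] at this
      simp [hT, this]
    rw [hπ, h0]; ring
  rw [← hG0]
  exact (hGc.continuousAt.tendsto.mono_left nhdsWithin_le_nhds).congr' hGJ

end

/-! ### Ovals: location, integrals and existence. -/

/-- A uniquely covered circle has total angle `2π`. -/
theorem exists_angle_of_rotation {u w μ : ℝ → ℝ} {ρ : ℝ} (hρ : 0 < ρ)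
    (hu : ∀ s, HasDerivAt u (μ s * w s) s) (hw : ∀ s, HasDerivAt w (-(μ s * u s)) s)
    (hμ : Continuous μ) (hμ0 : ∀ s, 0 < μ s) (hcirc : ∀ s, u s ^ 2 + w s ^ 2 = ρ ^ 2)
    (hu1 : u 1 = u 0) (hw1 : w 1 = w 0)
    (hinj : ∀ s ∈ Ico (0 : ℝ) 1, u s = u 0 → w s = w 0 → s = 0) :
    ∃ ψ : ℝ → ℝ, (∀ s, HasDerivAt ψ (μ s) s) ∧ (∀ s, u s = ρ * Real.cos (ψ s)) ∧
      (∀ s, w s = -(ρ * Real.sin (ψ s))) ∧ ψ 1 = ψ 0 + 2 * π := by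
  obtain ⟨ψ₀, h1, h2⟩ : ∃ ψ₀, u 0 = ρ * Real.cos ψ₀ ∧ w 0 = -(ρ * Real.sin ψ₀) := by
    set z : ℂ := ⟨u 0, -w 0⟩ with hz
    have hn : ‖z‖ = ρ := by
      rw [Complex.norm_eq_sqrt_sq_add_sq, ← Real.sqrt_sq hρ.le, ← hcirc 0]
      simp [hz]
    refine ⟨z.arg, ?_, ?_⟩
    · rw [← hn, Complex.norm_mul_cos_arg]
    · rw [← hn, Complex.norm_mul_sin_arg]; simp [hz]
  set ψ : ℝ → ℝ := fun s => ψ₀ + ∫ x in (0 : ℝ)..s, μ x with hψ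
  have hd : ∀ s, HasDerivAt ψ (μ s) s := fun s =>
    ((hμ.integral_hasStrictDerivAt 0 s).hasDerivAt).const_add ψ₀
  have hψ0 : ψ 0 = ψ₀ := by simp [hψ]
  have hcos : ∀ s, HasDerivAt (fun s => Real.cos (ψ s)) (-Real.sin (ψ s) * μ s) s :=
    fun s => (hd s).cos
  have hsin : ∀ s, HasDerivAt (fun s => Real.sin (ψ s)) (Real.cos (ψ s) * μ s) s :=
    fun s => (hd s).sin
  -- Rotating (u,w) back through the angle ψ freezes it; `hA` and `hB` are the two constant
  -- coordinates.
  have hA : ∀ s, u s * Real.cos (ψ s) - w s * Real.sin (ψ s) = ρ := by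
    intro s
    have hder : ∀ s, HasDerivAt (fun s => u s * Real.cos (ψ s) - w s * Real.sin (ψ s)) 0 s :=
      fun s => (((hu s).mul (hcos s)).sub ((hw s).mul (hsin s))).congr_deriv (by ring)
    have := is_const_of_deriv_eq_zero (fun s => (hder s).differentiableAt)
      (fun s => (hder s).deriv) s 0
    simp only [hψ0] at this
    rw [this, h1, h2]
    linear_combination ρ * Real.sin_sq_add_cos_sq ψ₀
  have hB : ∀ s, u s * Real.sin (ψ s) + w s * Real.cos (ψ s) = 0 := by
    intro s
    have hder : ∀ s, HasDerivAt (fun s => u s * Real.sin (ψ s) + w s * Real.cos (ψ s)) 0 s :=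
      fun s => (((hu s).mul (hsin s)).add ((hw s).mul (hcos s))).congr_deriv (by ring)
    have := is_const_of_deriv_eq_zero (fun s => (hder s).differentiableAt)
      (fun s => (hder s).deriv) s 0
    simp only [hψ0] at this
    rw [this, h1, h2]
    ring
  have hus : ∀ s, u s = ρ * Real.cos (ψ s) := fun s => by
    linear_combination Real.cos (ψ s) * hA s + Real.sin (ψ s) * hB s
      - u s * Real.sin_sq_add_cos_sq (ψ s)
  have hws : ∀ s, w s = -(ρ * Real.sin (ψ s)) := fun s => by
    linear_combination -Real.sin (ψ s) * hA s + Real.cos (ψ s) * hB s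
      - w s * Real.sin_sq_add_cos_sq (ψ s)
  have hmono : StrictMono ψ := strictMono_of_deriv_pos fun s => by rw [(hd s).deriv]; exact hμ0 s
  have hψc : Continuous ψ := continuous_iff_continuousAt.2 fun s => (hd s).continuousAt
  refine ⟨ψ, hd, hus, hws, ?_⟩
  have hc : Real.cos (ψ 1) = Real.cos (ψ 0) :=
    mul_left_cancel₀ hρ.ne' (by rw [← hus, ← hus, hu1])
  have hs : Real.sin (ψ 1) = Real.sin (ψ 0) :=
    mul_left_cancel₀ hρ.ne' (neg_injective (by rw [← hws, ← hws, hw1]))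
  obtain ⟨n, hn⟩ := Real.Angle.angle_eq_iff_two_pi_dvd_sub.1 (Real.Angle.cos_sin_inj hc hs)
  have hlt : ψ 0 < ψ 1 := hmono one_pos
  have hn1 : 1 ≤ n := by
    by_contra hcon
    have : (n : ℝ) ≤ 0 := by exact_mod_cast (by omega : n ≤ 0)
    nlinarith [Real.pi_pos]
  -- A second turn would pass through the starting point at an interior time, against injectivity.
  have hn2 : n ≤ 1 := by
    by_contra hcon
    have h2n : (2 : ℝ) ≤ n := by exact_mod_cast (by omega : 2 ≤ n)
    have hle : ψ 0 + 2 * π < ψ 1 := by nlinarith [Real.pi_pos]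
    obtain ⟨s, hs01, hs⟩ := intermediate_value_Ioo zero_le_one hψc.continuousOn
      (⟨by linarith [Real.pi_pos], hle⟩ : ψ 0 + 2 * π ∈ Ioo (ψ 0) (ψ 1))
    refine hs01.1.ne' (hinj s (Ioo_subset_Ico_self hs01) ?_ ?_)
    · rw [hus, hus, hs, Real.cos_add_two_pi]
    · rw [hws, hws, hs, Real.sin_add_two_pi]
  have : n = 1 := le_antisymm hn2 hn1
  rw [this] at hn
  push_cast at hn
  linarith

section
variable {a : ℝ} {ξ : ℝ → ℝ} {t : ℝ}

theorem hamField_eq (a : ℝ) (p : ℝ × ℝ) : hamField a p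
    = (2 * p.1 * p.2, -(p.2 ^ 2 + 3 * (p.1 - 1) * (a * (p.1 - 1) + 2))) := by
  have h1 : HasDerivAt (fun y => hamH a p.1 y) (2 * p.1 * p.2) p.2 := by
    unfold hamH
    refine ((((hasDerivAt_pow 2 p.2).add_const (a * p.1 ^ 2)).sub_const
      (3 * (a - 1) * p.1)).add_const (3 * (a - 2)) |>.const_mul p.1).congr_deriv ?_
    simp; ring
  have h2 : HasDerivAt (fun x => hamH a x p.2)
      (p.2 ^ 2 + 3 * (p.1 - 1) * (a * (p.1 - 1) + 2)) p.1 := by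
    unfold hamH
    refine ((hasDerivAt_id p.1).mul (((((hasDerivAt_pow 2 p.1).const_mul a).const_add
      (p.2 ^ 2)).sub ((hasDerivAt_id p.1).const_mul (3 * (a - 1)))).add_const
      (3 * (a - 2)))).congr_deriv ?_
    simp; ring
  rw [hamField, h1.deriv, h2.deriv]

/-- H is zero on x = 0 and positive on x = 3, so the oval crosses neither line. If it left the strip
it would also miss x = 1, and this unbounded line through the center would lie in one component of
the complement. -/
theorem IsOval.mem_Ioo {γ : ℝ → ℝ × ℝ} (hγ : IsOval a t γ) (ha : -1 < a) (ht : t < 0) (s : ℝ) :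
    (γ s).1 ∈ Ioo (0 : ℝ) 3 := by
  have hcont : Continuous fun s => (γ s).1 := continuous_fst.comp hγ.contDiff.continuous
  have h0 : ∀ s, (γ s).1 ≠ 0 := fun s e => by
    have := hγ.level s
    rw [e, hamH] at this; linarith
  have h3 : ∀ s, (γ s).1 ≠ 3 := fun s e => by
    have := hγ.level s
    rw [e, hamH] at this; nlinarith [sq_nonneg (γ s).2]
  by_contra hs
  have h1 : ∀ s', (γ s').1 ≠ 1 := by
    intro s' e
    rcases lt_or_ge (γ s).1 0 with hlt | hge
    · obtain ⟨x, hx⟩ := mem_range_of_exists_le_of_exists_ge hcont ⟨s, hlt.le⟩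
        ⟨s', by rw [e]; norm_num⟩
      exact h0 x hx
    · have hge3 : 3 ≤ (γ s).1 := by
        by_contra hlt
        exact hs ⟨lt_of_le_of_ne hge (h0 s).symm, not_le.1 hlt⟩
      obtain ⟨x, hx⟩ := mem_range_of_exists_le_of_exists_ge (c := (3 : ℝ)) hcont
        ⟨s', by rw [e]; norm_num⟩ ⟨s, hge3⟩
      exact h3 x hx
  have hline : IsPreconnected (range fun y : ℝ => ((1, y) : ℝ × ℝ)) :=
    isPreconnected_range (by fun_prop)
  have hsub := hline.subset_connectedComponentIn (x := ((1, 0) : ℝ × ℝ)) (F := (range γ)ᶜ)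
    ⟨0, rfl⟩ (by
      rintro _ ⟨y, rfl⟩ ⟨s', hs'⟩
      exact h1 s' (by rw [hs']))
  obtain ⟨C, hC⟩ := (hγ.surrounds.subset hsub).exists_norm_le
  have := hC (1, |C| + 1) ⟨_, rfl⟩
  have h2 := (norm_snd_le ((1, |C| + 1) : ℝ × ℝ)).trans this
  rw [Real.norm_of_nonneg (by positivity)] at h2
  linarith [le_abs_self C]

theorem radialDens_eq {k : Fin 3} {u : ℝ} (hx : 0 < ξ u) :
    radialDens a ξ k u = ξ u ^ ((k : ℤ) - 1) / √(ξ u) * (radialDeriv a (ξ u))⁻¹ := by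
  have hs := Real.sqrt_pos.2 hx
  have hsq : √(ξ u) ^ 2 = ξ u := Real.sq_sqrt hx.le
  unfold radialDens
  congr 1
  fin_cases k
  · simp; field_simp
  · simp
  · simp only [Fin.reduceFinMk, Matrix.cons_val]
    rw [eq_div_iff hs.ne', ← pow_two, hsq]
    simp

/-- In the coordinates (u,w) the motion along any admissible parametrization is a rotation with
positive speed μ. Its angle, gaining 2π in one period, is substituted into the integral. -/
theorem ovalIntegral_eq_abelInt (h : IsRadialInv a ξ) (ht : t ∈ Ioo (a - 3) 0)
    {γ : ℝ → ℝ × ℝ} (hγ : IsOval a t γ) (k : Fin 3) :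
    ovalIntegral γ ((k : ℤ) - 1) = abelInt a ξ t k := by
  have ha := h.gt_neg_one
  have ha' := h.lt_two
  have hpos : 0 < t + 3 - a := by linarith [ht.1]
  have hρ := Real.sqrt_pos.2 hpos
  have hρR := abs_sqrt_lt ht
  have hsq := Real.sq_sqrt hpos.le
  set ρ := √(t + 3 - a) with hρdef
  have hmem := hγ.mem_Ioo ha ht.2
  have hmem' : ∀ s, (γ s).1 ∈ Icc (0 : ℝ) 3 := fun s => Ioo_subset_Icc_self (hmem s)
  choose lam hlam0 hlam using hγ.oriented
  have hγd : ∀ s, HasDerivAt γ (deriv γ s) s := fun s =>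
    (hγ.contDiff.differentiable one_ne_zero s).hasDerivAt
  have hγc : Continuous γ := hγ.contDiff.continuous
  have hγ'c : Continuous (deriv γ) := hγ.contDiff.continuous_deriv le_rfl
  have hx : ∀ s, HasDerivAt (fun s => (γ s).1) (deriv γ s).1 s := fun s => (hγd s).fst
  have hy : ∀ s, HasDerivAt (fun s => (γ s).2) (deriv γ s).2 s := fun s => (hγd s).snd
  have hx' : ∀ s, (deriv γ s).1 = lam s * (2 * (γ s).1 * (γ s).2) := fun s => by
    rw [hlam s, hamField_eq]; rfl
  have hy' : ∀ s, (deriv γ s).2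
      = lam s * -((γ s).2 ^ 2 + 3 * ((γ s).1 - 1) * (a * ((γ s).1 - 1) + 2)) := fun s => by
    rw [hlam s, hamField_eq]; rfl
  set u : ℝ → ℝ := fun s => radial a (γ s).1 with hu
  set w : ℝ → ℝ := fun s => √(γ s).1 * (γ s).2 with hw
  set μ : ℝ → ℝ := fun s => 2 * lam s * √(γ s).1 * radialDeriv a (γ s).1 with hμ
  have hsx : ∀ s, 0 < √(γ s).1 := fun s => Real.sqrt_pos.2 (hmem s).1
  have hsx2 : ∀ s, √(γ s).1 ^ 2 = (γ s).1 := fun s => Real.sq_sqrt (hmem s).1.le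
  have hR : ∀ s, 0 < radialDeriv a (γ s).1 := fun s => radialDeriv_pos ha ha' (hmem' s)
  have hud' : ∀ s, HasDerivAt u (radialDeriv a (γ s).1 * (deriv γ s).1) s := fun s =>
    HasDerivAt.comp (h₂ := radial a) (h := fun s => (γ s).1) s
      (hasDerivAt_radial ha ha' (hmem' s)) (hx s)
  have hwd' : ∀ s, HasDerivAt w
      ((deriv γ s).1 / (2 * √(γ s).1) * (γ s).2 + √(γ s).1 * (deriv γ s).2) s := fun s =>
    ((hx s).sqrt (hmem s).1.ne').mul (hy s)
  have eu : ∀ s, radialDeriv a (γ s).1 * (deriv γ s).1 = μ s * w s := fun s => by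
    simp only [hx', hμ, hw]
    linear_combination (-2 * lam s * radialDeriv a (γ s).1 * (γ s).2) * hsx2 s
  have ew : ∀ s, (deriv γ s).1 / (2 * √(γ s).1) * (γ s).2 + √(γ s).1 * (deriv γ s).2
      = -(μ s * u s) := fun s => by
    have h1 := radial_mul_radialDeriv ha ha' (hmem' s)
    have h2 := hsx s
    have h3 := hsx2 s
    simp only [hx', hy', hμ, hu]
    have h4 : lam s * (2 * (γ s).1 * (γ s).2) / (2 * √(γ s).1)
        = lam s * √(γ s).1 * (γ s).2 := by
      rw [div_eq_iff (by positivity)]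
      linear_combination (-2 * lam s * (γ s).2) * h3
    rw [h4]
    linear_combination (2 * lam s * √(γ s).1) * h1
  have hcirc : ∀ s, u s ^ 2 + w s ^ 2 = ρ ^ 2 := fun s => by
    have h1 := hγ.level s
    rw [hamH_eq ha ha' (hmem' s)] at h1
    rw [hsq]
    simp only [hu, hw, mul_pow, hsx2]
    linarith
  have hRc : Continuous fun s => radialDeriv a (γ s).1 :=
    (continuousOn_radialDeriv ha ha').comp_continuous (by fun_prop) hmem'
  have huc : Continuous u := continuous_iff_continuousAt.2 fun s => (hud' s).continuousAt
  have hwc : Continuous w := by simp only [hw]; fun_prop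
  have hμc : Continuous μ := by
    -- The factors `lam` come from a choice and carry no continuity; it is recovered from μ = (u'w -
    -- w'u)/ρ².
    have h1 : μ = fun s => (radialDeriv a (γ s).1 * (deriv γ s).1 * w s
        - ((deriv γ s).1 / (2 * √(γ s).1) * (γ s).2 + √(γ s).1 * (deriv γ s).2) * u s)
          / ρ ^ 2 := by
      ext s
      rw [eu, ew, eq_div_iff (by positivity), ← hcirc s]; ring
    have h2 : Continuous fun s => (deriv γ s).1 / (2 * √(γ s).1) :=
      (by fun_prop : Continuous fun s => (deriv γ s).1).div (by fun_prop) fun s => by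
        have := hsx s; positivity
    rw [h1]
    fun_prop
  have hper : γ 1 = γ 0 := by simpa using hγ.periodic 0
  have hinj : ∀ s s', u s = u s' → w s = w s' → γ s = γ s' := by
    intro s s' h1 h2
    have e1 : (γ s).1 = (γ s').1 := (strictMonoOn_radial ha ha').injOn (hmem' s) (hmem' s') h1
    refine Prod.ext e1 ?_
    simp only [hw, e1] at h2
    exact mul_left_cancel₀ (hsx s').ne' h2
  obtain ⟨ψ, hψ, hψu, hψw, hψ1⟩ := exists_angle_of_rotation hρ
    (fun s => (hud' s).congr_deriv (eu s)) (fun s => (hwd' s).congr_deriv (ew s)) hμc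
    (fun s => mul_pos (mul_pos (mul_pos two_pos (hlam0 s)) (hsx s)) (hR s)) hcirc
    (by simp only [hu, hper]) (by simp only [hw, hper])
    (fun s hs h1 h2 => hγ.injOn hs ⟨le_rfl, one_pos⟩ (hinj s 0 h1 h2))
  set G : ℝ → ℝ := fun θ => radialDens a ξ k (ρ * Real.cos θ) * (ρ ^ 2 * Real.sin θ ^ 2) with hG
  have hGc : Continuous G :=
    (continuous_comp_mul_cos (continuousOn_radialDens h k) hρR).mul (by fun_prop)
  have hint : ovalIntegral γ ((k : ℤ) - 1) = ∫ s in (0 : ℝ)..1, (G ∘ ψ) s * μ s := by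
    unfold ovalIntegral
    congr 1; ext s
    have hξ : ξ (ρ * Real.cos (ψ s)) = (γ s).1 := by
      rw [← hψu]; exact h.left_inv _ (hmem' s)
    have hsin : ρ ^ 2 * Real.sin (ψ s) ^ 2 = w s ^ 2 := by rw [hψw]; ring
    simp only [Function.comp, hG]
    rw [hsin, radialDens_eq (by rw [hξ]; exact (hmem s).1), hξ]
    have e1 : (deriv γ s).1 = (radialDeriv a (γ s).1)⁻¹ * (μ s * w s) := by
      rw [← eu]; have := (hR s).ne'; field_simp
    have e2 : (γ s).2 = w s / √(γ s).1 := by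
      rw [hw]; have := (hsx s).ne'; field_simp
    rw [e1, e2]
    ring
  rw [hint, intervalIntegral.integral_comp_mul_deriv (fun s _ => hψ s) hμc.continuousOn hGc, hψ1]
  have hGper : Function.Periodic G (2 * π) := fun θ => by
    simp only [hG, Real.cos_add_two_pi, Real.sin_add_two_pi]
  rw [hGper.intervalIntegral_add_eq (ψ 0) 0, zero_add,
    ← intervalIntegral.integral_add_adjacent_intervals (hGc.intervalIntegrable 0 π)
      (hGc.intervalIntegrable π (2 * π))]
  -- Symmetry in y: the lower and upper arcs contribute equally, whence the factor 2 in `abelInt`.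
  have hrefl : ∫ θ in π..(2 * π), G θ = ∫ θ in (0 : ℝ)..π, G θ := by
    have h1 := intervalIntegral.integral_comp_sub_left (a := 0) (b := π) G (2 * π)
    rw [sub_zero, show 2 * π - π = π by ring] at h1
    rw [← h1]
    congr 1; ext θ
    simp only [hG, Real.cos_two_pi_sub, Real.sin_two_pi_sub, neg_sq]
  rw [hrefl, abelInt]
  ring

/-- A parametrization of the oval. -/
def ovalCurve (ξ : ℝ → ℝ) (ρ s : ℝ) : ℝ × ℝ :=
  (ξ (ρ * Real.cos (2 * π * s)),
    -(ρ * Real.sin (2 * π * s)) / √(ξ (ρ * Real.cos (2 * π * s))))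

/-- The circle is run clockwise, hence the minus sign in the second coordinate of the curve; this
makes the factor in front of the Hamiltonian field positive. -/
theorem hasDerivAt_ovalCurve (h : IsRadialInv a ξ) {ρ : ℝ} (hρ : |ρ| < √(3 - a)) (s : ℝ) :
    HasDerivAt (ovalCurve ξ ρ)
      ((π / (√(ovalCurve ξ ρ s).1 * radialDeriv a (ovalCurve ξ ρ s).1))
        • hamField a (ovalCurve ξ ρ s)) s := by
  have hu := mul_cos_mem hρ (2 * π * s)
  have hx := (h.mem_Ioo hu).1
  have hR := radialDeriv_pos h.gt_neg_one h.lt_two (Ioo_subset_Icc_self (h.mem_Ioo hu))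
  have hm := h.mul_radialDeriv (Ioo_subset_Icc_self hu)
  have hs := Real.sqrt_pos.2 hx
  have hsq : √(ξ (ρ * Real.cos (2 * π * s))) ^ 2 = ξ (ρ * Real.cos (2 * π * s)) :=
    Real.sq_sqrt hx.le
  have dl : HasDerivAt (fun s : ℝ => 2 * π * s) (2 * π) s := by
    simpa using (hasDerivAt_id s).const_mul (2 * π)
  have dc := dl.cos.const_mul ρ
  have ds := dl.sin.const_mul ρ
  have dξ := (h.hasDerivAt hu).comp s dc
  have dy := ds.neg.div (dξ.sqrt hx.ne') hs.ne'
  refine (dξ.prodMk dy).congr_deriv ?_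
  rw [hamField_eq]
  simp only [ovalCurve, Prod.smul_mk, smul_eq_mul, Function.comp]
  have hm' : 3 * (ξ (ρ * Real.cos (2 * π * s)) - 1) * (a * (ξ (ρ * Real.cos (2 * π * s)) - 1) + 2)
      = 2 * (ρ * Real.cos (2 * π * s) * radialDeriv a (ξ (ρ * Real.cos (2 * π * s)))) := by
    rw [hm]; ring
  rw [hm']
  generalize radialDeriv a (ξ (ρ * Real.cos (2 * π * s))) = R at *
  generalize √(ξ (ρ * Real.cos (2 * π * s))) = v at *
  generalize ξ (ρ * Real.cos (2 * π * s)) = x at *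
  subst hsq
  refine Prod.ext ?_ ?_
  · simp only; field_simp
  · simp only [Pi.neg_apply]; field_simp; ring

theorem isOval_ovalCurve (h : IsRadialInv a ξ) (ht : t ∈ Ioo (a - 3) 0) :
    IsOval a t (ovalCurve ξ √(t + 3 - a)) := by
  have ha := h.gt_neg_one
  have ha' := h.lt_two
  have hpos : 0 < t + 3 - a := by linarith [ht.1]
  have hρ := Real.sqrt_pos.2 hpos
  have hρR := abs_sqrt_lt ht
  have hsq := Real.sq_sqrt hpos.le
  generalize √(t + 3 - a) = ρ at *
  have hd := hasDerivAt_ovalCurve h hρR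
  have hu : ∀ s, ρ * Real.cos (2 * π * s) ∈ Ioo (-√(3 - a)) √(3 - a) :=
    fun s => mul_cos_mem hρR _
  have hmem : ∀ s, (ovalCurve ξ ρ s).1 ∈ Ioo (0 : ℝ) 3 := fun s => h.mem_Ioo (hu s)
  have hmem' : ∀ s, (ovalCurve ξ ρ s).1 ∈ Icc (0 : ℝ) 3 := fun s => Ioo_subset_Icc_self (hmem s)
  have hrad : ∀ s, radial a (ovalCurve ξ ρ s).1 = ρ * Real.cos (2 * π * s) := fun s =>
    h.right_inv _ (h.Icc_subset (Ioo_subset_Icc_self (hu s)))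
  have hsx : ∀ s, 0 < √(ovalCurve ξ ρ s).1 := fun s => Real.sqrt_pos.2 (hmem s).1
  have hsnd : ∀ s, √(ovalCurve ξ ρ s).1 * (ovalCurve ξ ρ s).2 = -(ρ * Real.sin (2 * π * s)) :=
    fun s => mul_div_cancel₀ _ (hsx s).ne'
  have hR : ∀ s, 0 < radialDeriv a (ovalCurve ξ ρ s).1 := fun s =>
    radialDeriv_pos ha ha' (hmem' s)
  have hcont : Continuous (ovalCurve ξ ρ) :=
    continuous_iff_continuousAt.2 fun s => (hd s).continuousAt
  have hlevel : ∀ s, hamH a (ovalCurve ξ ρ s).1 (ovalCurve ξ ρ s).2 = t := fun s => by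
    rw [hamH_eq ha ha' (hmem' s), hrad]
    have h1 : (ovalCurve ξ ρ s).1 * (ovalCurve ξ ρ s).2 ^ 2 = (ρ * Real.sin (2 * π * s)) ^ 2 := by
      rw [← neg_sq (ρ * _), ← hsnd, mul_pow, Real.sq_sqrt (hmem s).1.le]
    rw [h1, mul_pow, mul_pow, Real.sin_sq, hsq]; ring
  have hcenter : ((1, 0) : ℝ × ℝ) ∉ range (ovalCurve ξ ρ) := by
    rintro ⟨s, hs⟩
    have := hlevel s
    rw [hs, hamH] at this
    linarith [ht.1]
  refine ⟨?_, ?_, ?_, hlevel, ?_, hcenter, ?_⟩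
  · refine contDiff_one_iff_deriv.2 ⟨fun s => (hd s).differentiableAt, ?_⟩
    have e : deriv (ovalCurve ξ ρ) = fun s => (π / (√(ovalCurve ξ ρ s).1
        * radialDeriv a (ovalCurve ξ ρ s).1)) • hamField a (ovalCurve ξ ρ s) :=
      funext fun s => (hd s).deriv
    have c1 : Continuous fun s => (ovalCurve ξ ρ s).1 := continuous_fst.comp hcont
    have hRc : Continuous fun s => radialDeriv a (ovalCurve ξ ρ s).1 :=
      (continuousOn_radialDeriv ha ha').comp_continuous c1 hmem'
    have hHF : Continuous (hamField a) := by rw [funext (hamField_eq a)]; fun_prop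
    rw [e]
    exact Continuous.smul (continuous_const.div (c1.sqrt.mul hRc) fun s =>
      (mul_pos (hsx s) (hR s)).ne') (hHF.comp hcont)
  · intro s
    have e : 2 * π * (s + 1) = 2 * π * s + 2 * π := by ring
    simp only [ovalCurve, e, Real.cos_add_two_pi, Real.sin_add_two_pi]
  · intro s hs s' hs' hss
    have hc : Real.cos (2 * π * s) = Real.cos (2 * π * s') :=
      mul_left_cancel₀ hρ.ne' (by rw [← hrad, ← hrad, hss])
    have hsn : Real.sin (2 * π * s) = Real.sin (2 * π * s') :=
      mul_left_cancel₀ hρ.ne' (neg_injective (by rw [← hsnd, ← hsnd, hss]))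
    obtain ⟨n, hn⟩ := Real.Angle.angle_eq_iff_two_pi_dvd_sub.1 (Real.Angle.cos_sin_inj hc hsn)
    have hn' : s - s' = n :=
      mul_left_cancel₀ (by positivity : 2 * π ≠ 0) (by rw [← hn]; ring)
    have h1 : (n : ℝ) < 1 := by linarith [hs.2, hs'.1]
    have h2 : (-1 : ℝ) < n := by linarith [hs.1, hs'.2]
    have h3 : n < 1 := by exact_mod_cast h1
    have h4 : -1 < n := by exact_mod_cast h2
    have : n = 0 := by omega
    rw [this, Int.cast_zero] at hn'
    linarith
  · exact fun s => ⟨_, div_pos Real.pi_pos (mul_pos (hsx s) (hR s)), (hd s).deriv⟩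
  -- The open sublevel set in the strip is bounded and contains the center. Its closure adds only
  -- points of the oval, so the component of the center cannot leave it.
  · set A : Set (ℝ × ℝ) := {p | 0 < p.1 ∧ p.1 < 3 ∧ hamH a p.1 p.2 < t} with hA
    have hHc : Continuous fun p : ℝ × ℝ => hamH a p.1 p.2 := by unfold hamH; fun_prop
    have hAo : IsOpen A :=
      (isOpen_lt continuous_const continuous_fst).inter
        ((isOpen_lt continuous_fst continuous_const).inter (isOpen_lt hHc continuous_const))
    have hAc : closure A ⊆ {p : ℝ × ℝ | 0 ≤ p.1 ∧ p.1 ≤ 3 ∧ hamH a p.1 p.2 ≤ t} := by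
      refine closure_minimal (fun p hp => ⟨hp.1.le, hp.2.1.le, hp.2.2.le⟩) ?_
      exact (isClosed_le continuous_const continuous_fst).inter
        ((isClosed_le continuous_fst continuous_const).inter (isClosed_le hHc continuous_const))
    have hAb : Bornology.IsBounded A := by
      refine ((Metric.isBounded_Icc (0 : ℝ) 3).prod (Metric.isBounded_Icc (-6 : ℝ) 6)).subset ?_
      rintro ⟨x, y⟩ ⟨h0, h3, hH⟩
      simp only at h0 h3 hH
      have hneg : x * (y ^ 2 + a * x ^ 2 - 3 * (a - 1) * x + 3 * (a - 2)) < 0 := by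
        rw [hamH] at hH; linarith [ht.2]
      have h1 : y ^ 2 + a * x ^ 2 - 3 * (a - 1) * x + 3 * (a - 2) < 0 := by
        by_contra hc
        exact absurd (mul_nonneg h0.le (not_lt.1 hc)) (not_le.2 hneg)
      have h2 : y ^ 2 ≤ 6 ^ 2 := by nlinarith
      exact ⟨⟨h0.le, h3.le⟩, abs_le.1 (abs_le_of_sq_le_sq h2 (by norm_num))⟩
    refine hAb.subset ?_
    have hmemc : ((1, 0) : ℝ × ℝ) ∈ (range (ovalCurve ξ ρ))ᶜ := hcenter
    refine isPreconnected_connectedComponentIn.subset_of_closure_inter_subset hAo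
      ⟨(1, 0), mem_connectedComponentIn hmemc, ?_⟩ ?_
    · refine ⟨one_pos, by norm_num, ?_⟩
      rw [hamH]; linarith [ht.1]
    · rintro ⟨x, y⟩ ⟨hp, hpc⟩
      obtain ⟨h0, h3, hH⟩ := hAc hp
      have hnot : ((x, y) : ℝ × ℝ) ∉ range (ovalCurve ξ ρ) :=
        connectedComponentIn_subset _ _ hpc
      simp only at h0 h3 hH
      have h0' : 0 < x := lt_of_le_of_ne h0 fun e => by
        rw [← e, hamH] at hH; linarith [ht.2]
      have h3' : x < 3 := lt_of_le_of_ne h3 fun e => by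
        rw [e, hamH] at hH; nlinarith [ht.2, sq_nonneg y]
      refine ⟨h0', h3', lt_of_le_of_ne hH fun e => hnot ?_⟩
      -- A point of the strip on the level t lies on the circle of radius ρ in the coordinates
      -- (u,w), so its argument gives a parameter on the curve.
      rw [hamH_eq ha ha' ⟨h0, h3⟩] at e
      have hsx0 := Real.sqrt_pos.2 h0'
      set z : ℂ := ⟨radial a x, -(√x * y)⟩ with hz
      have hn : ‖z‖ = ρ := by
        rw [Complex.norm_eq_sqrt_sq_add_sq, ← Real.sqrt_sq hρ.le]
        congr 1
        simp only [hz, neg_sq, mul_pow, Real.sq_sqrt h0]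
        linarith
      have hcos : ρ * Real.cos z.arg = radial a x := by rw [← hn, Complex.norm_mul_cos_arg]
      have hsin : ρ * Real.sin z.arg = -(√x * y) := by rw [← hn, Complex.norm_mul_sin_arg]
      refine ⟨z.arg / (2 * π), ?_⟩
      have e2 : 2 * π * (z.arg / (2 * π)) = z.arg := by field_simp
      simp only [ovalCurve, e2, hcos, hsin, h.left_inv x ⟨h0, h3⟩, neg_neg]
      rw [mul_div_cancel_left₀ _ hsx0.ne']

end

/-! ### The coefficient of the logarithm and the conclusion. -/

open Filter Topology in
theorem tendsto_log_mul_of_hasDerivAt {f : ℝ → ℝ} {f' : ℝ} (hf : HasDerivAt f f' 0)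
    (h0 : f 0 = 0) : Tendsto (fun t => Real.log t * f t) (𝓝[<] 0) (𝓝 0) := by
  have h1 : Tendsto (fun t => t⁻¹ * f t) (𝓝[<] 0) (𝓝 f') := by
    have := hasDerivAt_iff_tendsto_slope_zero.1 hf
    simp only [zero_add, h0, sub_zero, smul_eq_mul] at this
    exact this.mono_left (nhdsWithin_mono _ fun x (hx : x < 0) => hx.ne)
  have h2 := tendsto_log_mul_self_nhdsLT_zero.mul h1
  rw [zero_mul] at h2
  refine h2.congr' ?_
  filter_upwards [self_mem_nhdsWithin] with t ht
  have : t ≠ 0 := (mem_Iio.1 ht).ne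
  field_simp

open Filter Topology in
theorem exists_abelInt_expansion {a K r : ℝ} {ξ : ℝ → ℝ} (h : IsRadialInv a ξ)
    (hK : GeomBound K (holCoeff a)) (hL : GeomBound K (logCoeff a)) (hr0 : 0 < r)
    (hra : r ≤ 3 - a)
    (hr : ∀ t : ℝ, ‖t‖ < r → K * ‖t‖ < 1 ∧ wronskian a t ≠ 0 ∧ pfDelta a t ≠ 0) :
    ∃ d : ℕ → Fin 3 → ℝ, VecSeriesConverges d r ∧ ∀ t : ℝ, -r < t → t < 0 → ∀ i,
      abelInt a ξ t i = -2 * √(3 * (2 - a)) * vecSeries (holCoeff a) t i * Real.log |t|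
        + vecSeries d t i := by
  have ha := h.gt_neg_one
  have ha' := h.lt_two
  have hnorm : ∀ t ∈ Ioo (-r) 0, ‖t‖ < r := fun t ht => by
    rw [Real.norm_eq_abs, abs_lt]; exact ⟨ht.1, by linarith [ht.2]⟩
  have hfund := isPFFundamental_log (𝕜 := ℝ) ha.ne' ha'.ne (by linarith) hK hL hr
    (isOpen_Ioo (a := -r) (b := 0)) (isConnected_Ioo (by linarith)) (l := Real.log)
    (fun t ht => ⟨hnorm t ht, ht.2.ne, Real.hasDerivAt_log ht.2.ne⟩) (κ := 1) one_ne_zero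
  have hJ : IsPFSolution a (Ioo (-r) 0) (abelInt a ξ) := fun t ht =>
    isPFSolution_abelInt h t ⟨by linarith [ht.1], ht.2⟩
  obtain ⟨c, hc, -⟩ := hfund.2 _ hJ
  have hrep : ∀ t ∈ Ioo (-r) 0, ∀ i, abelInt a ξ t i = c 0 * polySol a t i
      + c 1 * vecSeries (holCoeff a) t i + c 2 * (Real.log t * vecSeries (holCoeff a) t i
        + vecSeries (logCoeff a) t i) := by
    intro t ht i
    have := congrFun (hc t ht) i
    simpa [Fin.sum_univ_three] using this
  have hK0 : K * ‖(0 : ℝ)‖ < 1 := by simp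
  have hQd := (hK.hasDerivAt hK0).1
  have hSd := (hL.hasDerivAt hK0).1
  have hQi := fun i => hasDerivAt_pi.1 hQd i
  have hQ0 : ∀ i : Fin 3, i ≠ 0 → vecSeries (holCoeff a) (0 : ℝ) i = 0 := by
    intro i hi
    rw [vecSeries_zero, holCoeff_zero]
    fin_cases i <;> simp at hi ⊢
  -- The combination annihilates the polynomial solution at 0. The terms in Q vanish too, since t
  -- ln|t| → 0 beats their simple zero, and `logCoeff_zero_eq` evaluates S.
  have hlim : c 2 * (a - 2) = 2 * (2 - a) * √(3 * (2 - a)) := by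
    have hQt : ∀ i : Fin 3, i ≠ 0 →
        Tendsto (fun t : ℝ => vecSeries (holCoeff a) t i) (𝓝[<] 0) (𝓝 0) := fun i hi => by
      have := (hQi i).continuousAt.tendsto
      rw [hQ0 i hi] at this
      exact this.mono_left nhdsWithin_le_nhds
    have hQl : ∀ i : Fin 3, i ≠ 0 →
        Tendsto (fun t : ℝ => Real.log t * vecSeries (holCoeff a) t i) (𝓝[<] 0) (𝓝 0) :=
      fun i hi => tendsto_log_mul_of_hasDerivAt (hQi i) (hQ0 i hi)
    have hSt : ∀ i : Fin 3,
        Tendsto (fun t : ℝ => vecSeries (logCoeff a) t i) (𝓝[<] 0) (𝓝 (logCoeff a 0 i)) :=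
      fun i => by
        have := (hasDerivAt_pi.1 hSd i).continuousAt.tendsto
        rw [vecSeries_zero] at this
        exact this.mono_left nhdsWithin_le_nhds
    have hPt : ∀ i : Fin 3,
        Tendsto (fun t : ℝ => polySol a t i) (𝓝[<] 0) (𝓝 (polySol a (0 : ℝ) i)) := fun i =>
      (differentiableAt_pi.1 (isPFSolution_polySol (𝕜 := ℝ) a univ 0 (mem_univ _)).1
        i).continuousAt.tendsto.mono_left nhdsWithin_le_nhds
    have hJt : ∀ i : Fin 3, i ≠ 0 → Tendsto (fun t => abelInt a ξ t i) (𝓝[<] 0)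
        (𝓝 (c 0 * polySol a (0 : ℝ) i + c 1 * 0 + c 2 * (0 + logCoeff a 0 i))) := by
      intro i hi
      refine ((((hPt i).const_mul (c 0)).add ((hQt i hi).const_mul (c 1))).add
        (((hQl i hi).add (hSt i)).const_mul (c 2))).congr' ?_
      filter_upwards [Ioo_mem_nhdsLT (by linarith : -r < 0)] with t ht
      exact (hrep t ht i).symm
    have := tendsto_nhds_unique (tendsto_abelInt h)
      (((hJt 1 (by decide)).const_mul (3 / 2 * (1 - a))).add
        ((hJt 2 (by decide)).const_mul a))
    rw [this]
    simp only [polySol, Matrix.cons_val, RCLike.ofReal_real_eq_id, id]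
    linear_combination (-c 2) * logCoeff_zero_eq a
  have hc2 : c 2 = -2 * √(3 * (2 - a)) :=
    mul_right_cancel₀ (sub_ne_zero.2 ha'.ne) (by rw [hlim]; ring)
  have hd : ∀ t : ℝ, |t| < r → ∀ i, HasSum
      (fun n => (c 0 * polyCoeff a n i + c 1 * holCoeff a n i + c 2 * logCoeff a n i) * t ^ n)
      (c 0 * polySol a t i + c 1 * vecSeries (holCoeff a) t i
        + c 2 * vecSeries (logCoeff a) t i) := by
    intro t ht i
    have hKt := (hr t ht).1
    refine ((((hasSum_polyCoeff a t i).mul_left (c 0)).add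
      ((hK.hasSum hKt i).mul_left (c 1))).add ((hL.hasSum hKt i).mul_left (c 2))).of_eq
      (fun n => ?_) rfl
    simp only [RCLike.ofReal_real_eq_id, id]
    ring
  refine ⟨fun n i => c 0 * polyCoeff a n i + c 1 * holCoeff a n i + c 2 * logCoeff a n i,
    fun i t ht => (hd t ht i).summable, fun t ht0 ht1 i => ?_⟩
  have hsum := (hd t (hnorm t ⟨ht0, ht1⟩) i).tsum_eq
  simp only [vecSeries, RCLike.ofReal_real_eq_id, id] at hsum ⊢
  rw [hsum, Real.log_abs]
  have := hrep t ⟨ht0, ht1⟩ i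
  simp only [vecSeries, RCLike.ofReal_real_eq_id, id] at this
  rw [this, hc2]
  ring

theorem logSystem_eq {𝕜 : Type} [RCLike 𝕜] {a : ℝ} (ha : a ≠ 0) (q s : ℕ → Fin 3 → ℝ)
    (l : 𝕜 → 𝕜) : logSystem a q s l = ![fun t => (9 / (8 * (a : 𝕜) ^ 2)) • polySol a t,
      vecSeries q, fun t => l t • vecSeries q t + vecSeries s t] := by
  rw [logSystem, linP_eq ha]

theorem GeomBound.vecSeriesConverges {K r : ℝ} {c : ℕ → Fin 3 → ℝ} (h : GeomBound K c)
    (hr : ∀ t : ℝ, ‖t‖ < r → K * ‖t‖ < 1) : VecSeriesConverges c r := fun i x hx => by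
  simpa only [RCLike.ofReal_real_eq_id, id] using h.summable (𝕜 := ℝ) (hr x hx) i

end

theorem lemma3 (a : ℝ) (ha1 : a ≠ -1) (ha2 : a ≠ 2) (ha3 : a ≠ 3) :
    ∃ (r : ℝ) (q : ℕ → Fin 3 → ℝ), 0 < r ∧
      -- the power series `Q` and its first coefficients
      VecSeriesConverges q r ∧
      q 0 = ![1, 0, 0] ∧
      q 1 = -![(a - 1) / (12 * (a - 2) ^ 2), 1 / (6 * (a - 2)), 0] ∧
      q 2 = -![(11 * a ^ 2 - 22 * a + 15) / (576 * (a - 2) ^ 4),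
              (a - 1) / (48 * (a - 2) ^ 3),
              1 / (72 * (a - 2) ^ 2)] ∧
      q 3 = -![35 * (a - 1) * (5 * a ^ 2 - 10 * a + 9) / (20736 * (a - 2) ^ 6),
              (85 * a ^ 2 - 170 * a + 105) / (10368 * (a - 2) ^ 5),
              5 * (a - 1) / (864 * (a - 2) ^ 4)] ∧
      IsPFSolution a (Metric.ball (0 : ℂ) r) (vecSeries q) ∧
      -- the fundamental system near `t = 0`
      (a ≠ 0 → ∃ s : ℕ → Fin 3 → ℝ, VecSeriesConverges s r ∧
        -- for real `t < 0` and real `t > 0`, with `Real.log t = ln |t|`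
        IsPFFundamental a (Set.Ioo (-r) 0) (logSystem a q s Real.log) ∧
        IsPFFundamental a (Set.Ioo 0 r) (logSystem a q s Real.log) ∧
        -- for complex `t`, with any branch `l` of the logarithm on any domain `U`
        ∀ (U : Set ℂ) (l : ℂ → ℂ), IsOpen U → IsConnected U →
          U ⊆ Metric.ball 0 r \ {0} → ContinuousOn l U → (∀ t ∈ U, Complex.exp (l t) = t) →
          IsPFFundamental a U (logSystem a q s l)) ∧
      -- the expansions of `J_{-1}, J_0, J_1` near `t = -0`
      (-1 < a → a < 2 → ∃ d : ℕ → Fin 3 → ℝ, VecSeriesConverges d r ∧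
        ∀ t : ℝ, -r < t → t < 0 →
          (∃ γ, IsOval a t γ) ∧
          ∀ γ, IsOval a t γ → ∀ i : Fin 3,
            ovalIntegral γ ((i : ℤ) - 1)
              = -2 * Real.sqrt (3 * (2 - a)) * vecSeries q t i * Real.log |t|
                + vecSeries d t i) := by
  obtain ⟨K, hK, hL⟩ := exists_geomBound_holCoeff_logCoeff ha1 ha2 ha3
  obtain ⟨r₁, hr₁, h₁⟩ := exists_radius ℝ ha1 ha2 ha3 hK hL
  obtain ⟨r₂, hr₂, h₂⟩ := exists_radius ℂ ha1 ha2 ha3 hK hL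
  have hab : 0 < |3 - a| := abs_pos.2 (sub_ne_zero.2 ha3.symm)
  -- Since H(1,0) = a - 3, the bound |3-a| keeps every t in (-r,0) above the level of the center in
  -- case (ii).
  set r := min (min r₁ r₂) |3 - a| with hrdef
  have hr : 0 < r := lt_min (lt_min hr₁ hr₂) hab
  have hR : ∀ t : ℝ, ‖t‖ < r → K * ‖t‖ < 1 ∧ wronskian a t ≠ 0 ∧ pfDelta a t ≠ 0 := fun t ht =>
    h₁ t (ht.trans_le ((min_le_left _ _).trans (min_le_left _ _)))
  have hC : ∀ t : ℂ, ‖t‖ < r → K * ‖t‖ < 1 ∧ wronskian a t ≠ 0 ∧ pfDelta a t ≠ 0 := fun t ht =>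
    h₂ t (ht.trans_le ((min_le_left _ _).trans (min_le_right _ _)))
  have hKr : ∀ t : ℝ, ‖t‖ < r → K * ‖t‖ < 1 := fun t ht => (hR t ht).1
  refine ⟨r, holCoeff a, hr, hK.vecSeriesConverges hKr, holCoeff_zero a,
    holCoeff_one ha1 ha2 ha3, holCoeff_two ha1 ha2 ha3, holCoeff_three ha1 ha2 ha3,
    isPFSolution_holCoeff ha1 ha2 ha3 hK fun t ht => (hC t (by simpa using ht)).1,
    fun ha0 => ⟨logCoeff a, hL.vecSeriesConverges hKr, ?_, ?_, ?_⟩, fun ha ha' => ?_⟩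
  · rw [logSystem_eq ha0]
    refine isPFFundamental_log ha1 ha2 ha3 hK hL hR isOpen_Ioo
      (isConnected_Ioo (by linarith)) (fun t ht => ⟨?_, ht.2.ne, Real.hasDerivAt_log ht.2.ne⟩)
      (by simpa using ha0)
    rw [Real.norm_eq_abs, abs_lt]; exact ⟨ht.1, by linarith [ht.2]⟩
  · rw [logSystem_eq ha0]
    refine isPFFundamental_log ha1 ha2 ha3 hK hL hR isOpen_Ioo
      (isConnected_Ioo hr) (fun t ht => ⟨?_, ht.1.ne', Real.hasDerivAt_log ht.1.ne'⟩)
      (by simpa using ha0)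
    rw [Real.norm_eq_abs, abs_lt]; exact ⟨by linarith [ht.1], ht.2⟩
  · intro U l hUo hUc hUsub hl hexp
    rw [logSystem_eq ha0]
    refine isPFFundamental_log ha1 ha2 ha3 hK hL hC hUo hUc (fun t ht => ?_)
      (by simpa using ha0)
    obtain ⟨hb, h0⟩ := hUsub ht
    refine ⟨by simpa using hb, h0, ?_⟩
    -- A continuous branch is a local inverse of the exponential, hence differentiable with
    -- derivative 1/t.
    have hd := HasDerivAt.of_local_left_inverse (hl.continuousAt (hUo.mem_nhds ht))
      (Complex.hasDerivAt_exp (l t)) (Complex.exp_ne_zero _)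
      (by filter_upwards [hUo.mem_nhds ht] with s hs using hexp s hs)
    rwa [hexp t ht] at hd
  · obtain ⟨ξ, hξ⟩ := exists_isRadialInv ha ha'
    have hr3 : r ≤ 3 - a := (min_le_right _ _).trans (abs_of_pos (by linarith)).le
    obtain ⟨d, hd, hexpand⟩ := exists_abelInt_expansion hξ hK hL hr hr3 hR
    refine ⟨d, hd, fun t ht0 ht1 => ?_⟩
    have ht : t ∈ Set.Ioo (a - 3) 0 := ⟨by linarith, ht1⟩
    refine ⟨⟨_, isOval_ovalCurve hξ ht⟩, fun γ hγ i => ?_⟩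
    rw [ovalIntegral_eq_abelInt hξ ht hγ i]
    exact hexpand t ht0 ht1 i
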